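/- For each $n\ge 1$ let $p=p_n,\ d=d_n\ge 1$ and $s_b,s_x\ge 0$ be integers, $Z\in\mathbb R^{n\times p}$ a covariate matrix with rows $z_1',\dots,z_n'$, $X^*\in\mathbb R^{n\times d}$ with rows $x_1^{*\prime},\dots,x_n^{*\prime}$, $B^*\in\mathbb R^{p\times d}$ with rows $b_1^{*\prime},\dots,b_p^{*\prime}$, and $\beta^*\in\mathbb R$ (all depending on $n$), such that at most $s_x$ indices $i$ have $x_i^*\neq B^{*\prime}z_i$ and at most $s_b$ indices $j$ have $b_j^*\ne 0$. The data are $\mathcal Y=(Y_{ij})_{1\le i\le j\le n}$, independent, with $$Y_{ij}\sim\mathrm{Bernoulli}\big(1/\{1+\exp(-\beta^*-x_i^{*\prime}x_j^*)\}\big).$$ Let $p_{X,\beta}$ be the joint probability mass function of $\mathcal Y$ when the parameters are $(X,\beta)$. For $\alpha\in(0,1)$ let $D_\alpha(p,q)=\frac1{\alpha-1}\log\sum_y p(y)^\alpha q(y)^{1-\alpha}$, and let $\Pi_\alpha(\cdot\mid\mathcal Y)$ be the $\alpha$-fractional posterior, i.e. the probability measure proportional to $p_{X,\beta}(\mathcal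 Y)^\alpha\,\Pi(dX)\,\Pi(d\beta)$. Here $\Pi(d\beta)=\Pi_n(d\beta)$ is a probability measure on $\mathbb R$ and $\Pi(dX)$ is the $X$-marginal of the horseshoe-type prior $$b_j\mid\lambda_b,\tau_b\sim\mathcal N(0,\lambda_{b_j}^2\tau_b^2I_d)\ (j\le p),\qquad x_i\mid B,\lambda_x,\tau_x\sim\mathcal N(B'z_i,\lambda_{x_i}^2\tau_x^2I_d)\ (i\le n),$$ (conditionally independent) with $\tau_b,\lambda_{b_j},\tau_x,\lambda_{x_i}$ independent standard half-Cauchy. For $M>0$ put $\epsilon_n(M)=M\sqrt{(1+s_b+s_x)\,d\log(np)/n^2}$. Fix positive constants $C_1,C_2,C_B,C_p,C_r,c_r,M_1,c_4,c_5$. There is a constant $\bar M>0$, depending only on these constants, such that for every $M_0\ge\bar M$ the following holds for all sequences as above for which 1. $|x^*_{ik}|\le C_1$ for all $n,i,k$, and $|b^*_{jk}|\le C_Bp^{C_2}$ for all $j,k$ and all large $n$; 2. for all large $n$, $\|Z\tilde B\|_F^2\le c_r\,n\,\|\tilde B\|_F^2$ for every $\tilde B\in\mathbb R^{p\times d}$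 with $\sum_j\|\tilde b_j\|_2\le C_r\max\{s_b,1\}\,d\log(np)$; 3. $\epsilon_n(M_1)\to0$, and $\log p\le C_p\log n$ for all large $n$; 4. $\epsilon_n(M_1)^2/e^{\beta^*}\to0$; 5. $\Pi_n(|\beta-\beta^*|\le c_4\epsilon_n(M_1))\ge c_5\,e^{-n^2\epsilon_n(M_1)^2}$ for all large $n$. Write $\epsilon_n=\epsilon_n(M_0)$. For every $\alpha\in(0,1)$ there are $n_0$ and a deterministic sequence $a_n\to0$ such that, for all $n\ge n_0$, $D\ge2$ and $\eta>0$, with probability at least $1-\dfrac{2}{(D-1+\eta)^2n^2\epsilon_n^2}$ under the true parameters, $$\Pi_\alpha\Big(\tfrac1{n^2}D_\alpha(p_{X,\beta},p_{X^*,\beta^*})\ge\tfrac{D+3\eta}{1-\alpha}\,\epsilon_n^2\ \Big|\ \mathcal Y\Big)\le a_n .$$ -/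

import Mathlib

open MeasureTheory ProbabilityTheory Filter Topology

namespace CALSM

noncomputable section

/-- Index set of the observed entries of the network: pairs `i ≤ j`, diagonal included. -/
abbrev Pairs (n : ℕ) : Type := {q : Fin n × Fin n // q.1 ≤ q.2}

/-- An observed network on `n` nodes. -/
abbrev Network (n : ℕ) : Type := Pairs n → Bool

/-- An array of `m` row vectors in `ℝ^d`. -/
abbrev Rows (m d : ℕ) : Type := Fin m → Fin d → ℝ

/-- The matrix product `Z B`; its `i`-th row is `B' zᵢ`. -/
def fitted {n p d : ℕ} (Z : Rows n p) (B : Rows p d) : Rows n d :=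
  fun i k => ∑ j, Z i j * B j k

/-- Number of nonzero rows of a matrix, the `ℓ_{2,0}` norm. -/
def rowSupport {m d : ℕ} (A : Rows m d) : ℕ := {i : Fin m | A i ≠ 0}.ncard

/-- Squared Frobenius norm. -/
def frobSq {m d : ℕ} (A : Rows m d) : ℝ := ∑ i, ∑ k, A i k ^ 2

/-- The `ℓ_{2,1}` norm: the sum of the Euclidean norms of the rows. -/
def norm21 {m d : ℕ} (A : Rows m d) : ℝ := ∑ i, √(∑ k, A i k ^ 2)

/-- The natural parameter `β + xᵢ' xⱼ` of the entry `(i, j)`. -/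
def logit {n d : ℕ} (X : Rows n d) (β : ℝ) (q : Pairs n) : ℝ :=
  β + ∑ k, X q.1.1 k * X q.1.2 k

/-- The Bernoulli-logistic latent space model: the entries `Y_{ij}`, `i ≤ j`, are independent,
`Y_{ij} ∼ Bernoulli (1 / (1 + exp (-β - xᵢ' xⱼ)))`. -/
def dataLaw {n d : ℕ} (X : Rows n d) (β : ℝ) : Measure (Network n) :=
  Measure.pi fun q => bernoulliMeasure true false (unitInterval.sigmoid (logit X β q))

/-- The density `p_{X,β}` of `dataLaw X β` with respect to the counting measure, that is, the
likelihood. -/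
def likelihood {n d : ℕ} (X : Rows n d) (β : ℝ) (y : Network n) : ℝ :=
  ∏ q, if y q then Real.sigmoid (logit X β q) else 1 - Real.sigmoid (logit X β q)

/-- Rényi divergence of order `α` between two densities with respect to the counting measure. -/
def renyi {Ω : Type*} [Fintype Ω] (α : ℝ) (f g : Ω → ℝ) : ℝ :=
  1 / (α - 1) * Real.log (∑ y, f y ^ α * g y ^ (1 - α))

/-- The standard half-Cauchy distribution `Ca⁺(0, 1)`. -/
def halfCauchy : Measure ℝ :=
  (volume.restrict (Set.Ioi 0)).withDensity
    fun t => ENNReal.ofReal (2 / (Real.pi * (1 + t ^ 2)))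

/-- The horseshoe law of `m` vectors in `ℝ^d`: a global scale `τ ∼ Ca⁺(0, 1)`, independent local
scales `λᵢ ∼ Ca⁺(0, 1)` and, given the scales, independent rows `vᵢ ∼ N(0, λᵢ² τ² I_d)`, generated
as `vᵢ = λᵢ τ gᵢ` with independent standard normal vectors `gᵢ`. -/
def horseshoe (m d : ℕ) : Measure (Rows m d) :=
  (halfCauchy.prod
    ((Measure.pi fun _ : Fin m => halfCauchy).prod
      (Measure.pi fun _ : Fin m => Measure.pi fun _ : Fin d => gaussianReal 0 1))).map
    fun w i k => w.2.1 i * w.1 * w.2.2 i k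

/-- The marginal prior of the latent positions: `B` follows the horseshoe law and, given `B`, the
`xᵢ` follow the horseshoe law centred at `B' zᵢ`. -/
def latentPrior {n p : ℕ} (d : ℕ) (Z : Rows n p) : Measure (Rows n d) :=
  ((horseshoe p d).prod (horseshoe n d)).map fun w => fitted Z w.1 + w.2

/-- The prior of `(X, β)`, with `β` independent of `X`. -/
def prior {n p : ℕ} (d : ℕ) (Z : Rows n p) (πβ : Measure ℝ) : Measure (Rows n d × ℝ) :=
  (latentPrior d Z).prod πβ

/-- The `α`-fractional posterior of `(X, β)` given the network `y`. -/
def fracPosterior {n p : ℕ} (d : ℕ) (α : ℝ) (Z : Rows n p) (πβ : Measure ℝ) (y : Network n) :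
    Measure (Rows n d × ℝ) :=
  (∫⁻ w, ENNReal.ofReal (likelihood w.1 w.2 y ^ α) ∂(prior d Z πβ))⁻¹ •
    (prior d Z πβ).withDensity fun w => ENNReal.ofReal (likelihood w.1 w.2 y ^ α)

/-- `rate M n p d sb sx = M √((1 + s_b + s_x) d log(np) / n²)`. -/
def rate (M : ℝ) (n p d sb sx : ℕ) : ℝ :=
  M * √((1 + (sb : ℝ) + sx) * d * Real.log (n * p) / (n : ℝ) ^ 2)

/-- The upper restricted-eigenvalue bound `‖Z B̃‖_F² ≤ c n ‖B̃‖_F²` for all `B̃` with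
`‖B̃‖_{2,1} ≤ C max(s_b, 1) d log(np)`. -/
def RestrictedUpperEigenvalue {n p : ℕ} (d sb : ℕ) (C c : ℝ) (Z : Rows n p) : Prop :=
  ∀ B : Rows p d, norm21 B ≤ C * (max sb 1 : ℕ) * d * Real.log (n * p) →
    frobSq (fitted Z B) ≤ c * n * frobSq B

end

end CALSM

namespace CALSM

/-! Write `W = np`, `S = (1 + s_b + s_x) d log(np)`, `N = n² ε_n² = M₀² S`, `w = D - 1 + η`, and let
`p*` be the true likelihood. After division by `(p*)^α`, the posterior mass of the set `U` of large
divergence is the quotient of `∫_U (p/p*)^α dΠ` by `∫ (p/p*)^α dΠ`; the two integrals are controlled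
separately.

Numerator: under the truth its mean is the integral over `U` of `exp(-(1-α) D_α)`, hence at most
`exp(-(D+3η)N)`. Markov's inequality then suffices, with no tests or sieves
(`dataLaw_numerator_le`).

Denominator: the integral is restricted to a set `V` where every entry of `X` is within `W⁻⁵` of the
truth and `β` is within `c₄ ε_n(M₁)`. There all logits move by `β - β*` up to an error `n⁻²`, so the
log-likelihood ratio is at least `(β - β*)` times the sum of the centred observations, minus a
deterministic `O(S)`. That sum does not depend on the point of `V`, so one application of
Chebyshev's inequality covers all of `V` (`likelihood_ge`, `dataLaw_totalScore_le`). Each of the two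
bad events has probability at most `1/(w² N)`.

Prior mass: `V` has mass at least `c₅ exp(-O(S))` (`prior_ball_ge`). This rests on
`horseshoe_ball_ge`: a polynomially small global scale shrinks the null rows almost for free, while
the heavy Cauchy tail lets each active row undo the shrinkage at a price polynomial in `W`, raised
to the power `d` for its Gaussian coordinates.

For `M₀` large, `N` dominates every `O(S)` term and the quotient is at most `exp(-S)`, which tends
to zero because `S ≥ log n`. -/

/-! ### Half-Cauchy and Gaussian probabilities of intervals. -/

lemma halfCauchy_Ioi {t : ℝ} (ht : 0 ≤ t) :
    halfCauchy (Set.Ioi t) = ENNReal.ofReal (2 / Real.pi * (Real.pi / 2 - Real.arctan t)) := by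
  have hpi := Real.pi_pos
  rw [halfCauchy, withDensity_apply _ measurableSet_Ioi, Measure.restrict_restrict measurableSet_Ioi,
    Set.inter_eq_left.2 (Set.Ioi_subset_Ioi ht), ← integral_Ioi_inv_one_add_sq,
    ← integral_const_mul, ofReal_integral_eq_lintegral_ofReal]
  · refine lintegral_congr fun x => ?_
    congr 1
    have : 0 < 1 + x ^ 2 := by positivity
    field_simp
  · exact (integrable_inv_one_add_sq.integrableOn).const_mul _
  · exact ae_of_all _ fun x => by positivity

lemma halfCauchy_Iic_zero : halfCauchy (Set.Iic 0) = 0 := by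
  rw [halfCauchy, withDensity_apply _ measurableSet_Iic, Measure.restrict_restrict measurableSet_Iic,
    Set.Iic_inter_Ioi, Set.Ioc_self, Measure.restrict_empty, lintegral_zero_measure]

instance : IsProbabilityMeasure halfCauchy where
  measure_univ := by
    have hpi := Real.pi_pos
    rw [← Set.Iic_union_Ioi (a := (0 : ℝ)), measure_union (Set.Iic_disjoint_Ioi le_rfl)
      measurableSet_Ioi, halfCauchy_Iic_zero, halfCauchy_Ioi le_rfl]
    rw [Real.arctan_zero, sub_zero, zero_add, ← ENNReal.ofReal_one]
    congr 1
    field_simp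

lemma halfCauchy_Ioc_ge {t : ℝ} (ht : 0 < t) :
    ENNReal.ofReal (1 - 1 / t) ≤ halfCauchy (Set.Ioc 0 t) := by
  have hpi := Real.pi_gt_three
  have h1 : halfCauchy (Set.Ioi t) ≤ ENNReal.ofReal (1 / t) := by
    rw [halfCauchy_Ioi ht.le, ← Real.arctan_inv_of_pos ht]
    apply ENNReal.ofReal_le_ofReal
    have h2 : Real.arctan t⁻¹ ≤ t⁻¹ := by
      have h := Real.le_tan (x := Real.arctan t⁻¹) (Real.arctan_nonneg.2 (by positivity))
        (Real.arctan_lt_pi_div_two _)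
      rwa [Real.tan_arctan] at h
    have h4 : 2 / Real.pi ≤ 1 := by rw [div_le_one (by positivity)]; linarith
    have h3 : 0 ≤ Real.arctan t⁻¹ := Real.arctan_nonneg.2 (by positivity)
    rw [one_div]
    nlinarith
  have h2 : (1 : ENNReal) ≤ halfCauchy (Set.Ioc 0 t) + ENNReal.ofReal (1 / t) := by
    have hcov : (Set.univ : Set ℝ) ⊆ (Set.Iic 0 ∪ Set.Ioc 0 t) ∪ Set.Ioi t := fun x _ => by
      simp only [Set.mem_union, Set.mem_Iic, Set.mem_Ioc, Set.mem_Ioi]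
      grind
    calc (1 : ENNReal) = halfCauchy Set.univ := measure_univ.symm
      _ ≤ _ := measure_mono hcov
      _ ≤ halfCauchy (Set.Iic 0) + halfCauchy (Set.Ioc 0 t) + halfCauchy (Set.Ioi t) :=
        (measure_union_le _ _).trans (add_le_add (measure_union_le _ _) le_rfl)
      _ ≤ _ := by rw [halfCauchy_Iic_zero, zero_add]; gcongr
  rw [ENNReal.ofReal_sub _ (by positivity), ENNReal.ofReal_one]
  exact tsub_le_iff_right.2 h2

lemma halfCauchy_Icc_ge {a b : ℝ} (ha : 0 < a) :
    ENNReal.ofReal ((b - a) * (2 / (Real.pi * (1 + b ^ 2)))) ≤ halfCauchy (Set.Icc a b) := by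
  have hpi := Real.pi_pos
  rw [halfCauchy, withDensity_apply _ measurableSet_Icc, Measure.restrict_restrict measurableSet_Icc,
    Set.inter_eq_left.2 (show Set.Icc a b ⊆ Set.Ioi 0 from fun x hx => ha.trans_le hx.1), mul_comm,
    ENNReal.ofReal_mul (by positivity), ← Real.volume_Icc, ← setLIntegral_const]
  refine setLIntegral_mono (by fun_prop) fun x hx => ENNReal.ofReal_le_ofReal ?_
  have : 0 < x := ha.trans_le hx.1
  have := hx.2
  gcongr

/-- The interval lies in `[-2, 2]`, where the density is at least `(1/3)(1/9) > 1/32`. -/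
lemma gaussianReal_Icc_ge {a δ : ℝ} (ha : |a| ≤ 1) (hδ : 0 ≤ δ) (hδ1 : δ ≤ 1) :
    ENNReal.ofReal (δ / 16) ≤ gaussianReal 0 1 (Set.Icc (a - δ) (a + δ)) := by
  rw [gaussianReal_apply _ one_ne_zero]
  have h : ENNReal.ofReal (δ / 16) ≤
      ∫⁻ _ in Set.Icc (a - δ) (a + δ), ENNReal.ofReal (1 / 32) := by
    rw [setLIntegral_const, Real.volume_Icc, ← ENNReal.ofReal_mul (by norm_num)]
    apply ENNReal.ofReal_le_ofReal
    linarith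
  refine h.trans (setLIntegral_mono (measurable_gaussianPDF _ _) fun x hx => ?_)
  rw [gaussianPDF_def]
  apply ENNReal.ofReal_le_ofReal
  rw [gaussianPDFReal_def]
  have hx2 : x ^ 2 ≤ 4 := by
    have := abs_le.1 ha
    nlinarith [hx.1, hx.2]
  have h1 : √(2 * Real.pi) ≤ 3 := by
    rw [Real.sqrt_le_left (by norm_num)]
    nlinarith [Real.pi_lt_four]
  have h2 : (1 : ℝ) / 9 ≤ Real.exp (-2) := by
    rw [Real.exp_neg, ← one_div]
    apply one_div_le_one_div_of_le (Real.exp_pos _)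
    have : Real.exp 2 = Real.exp 1 ^ 2 := by rw [← Real.exp_nat_mul]; norm_num
    rw [this]
    nlinarith [Real.exp_one_lt_d9, Real.exp_pos 1]
  have h3 : Real.exp (-2) ≤ Real.exp (-x ^ 2 / 2) := Real.exp_le_exp.2 (by linarith)
  have h4 : (1 : ℝ) / 3 ≤ (√(2 * Real.pi))⁻¹ := by
    rw [← one_div]; exact one_div_le_one_div_of_le (by positivity) h1
  simp only [NNReal.coe_one, mul_one, sub_zero]
  nlinarith

/-- Chebyshev's inequality; a polynomial tail bound is enough, since `u` will be a power of `W`. -/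
lemma gaussianReal_Ioo_ge {u : ℝ} (hu : 0 < u) :
    ENNReal.ofReal (1 - 1 / u ^ 2) ≤ gaussianReal 0 1 (Set.Ioo (-u) u) := by
  have h := meas_ge_le_variance_div_sq (μ := gaussianReal 0 1) (memLp_id_gaussianReal 2) hu
  rw [variance_id_gaussianReal] at h
  simp only [id_eq, integral_id_gaussianReal, sub_zero, NNReal.coe_one] at h
  have h2 : (1 : ENNReal) ≤ gaussianReal 0 1 (Set.Ioo (-u) u) + ENNReal.ofReal (1 / u ^ 2) := by
    have hcov : (Set.univ : Set ℝ) ⊆ Set.Ioo (-u) u ∪ {x | u ≤ |x|} := fun x _ => by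
      simp only [Set.mem_union, Set.mem_Ioo, Set.mem_ofPred_eq]
      rw [← abs_lt]
      exact lt_or_ge _ _
    calc (1 : ENNReal) = gaussianReal 0 1 Set.univ := measure_univ.symm
      _ ≤ _ := measure_mono hcov
      _ ≤ _ := measure_union_le _ _
      _ ≤ _ := by gcongr
  rw [ENNReal.ofReal_sub _ (by positivity), ENNReal.ofReal_one]
  exact tsub_le_iff_right.2 h2

/-! ### Horseshoe mass near row-sparse arrays. -/

instance (m d : ℕ) : IsProbabilityMeasure (horseshoe m d) :=
  Measure.isProbabilityMeasure_map (by fun_prop)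

lemma horseshoe_ge_of_rectangle {m d : ℕ} {S : Set (Rows m d)} {A₀ : Set ℝ} {A : Fin m → Set ℝ}
    {G : Fin m → Fin d → Set ℝ}
    (h : ∀ t ∈ A₀, ∀ l : Fin m → ℝ, (∀ j, l j ∈ A j) → ∀ g : Rows m d, (∀ j k, g j k ∈ G j k) →
      (fun j k => l j * t * g j k) ∈ S) :
    halfCauchy A₀ * ((∏ j, halfCauchy (A j)) * ∏ j, ∏ k, gaussianReal 0 1 (G j k)) ≤
      horseshoe m d S := by
  have h1 : (halfCauchy.prod ((Measure.pi fun _ : Fin m => halfCauchy).prod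
      (Measure.pi fun _ : Fin m => Measure.pi fun _ : Fin d => gaussianReal 0 1)))
      (A₀ ×ˢ ((Set.univ.pi A) ×ˢ (Set.univ.pi fun j => Set.univ.pi (G j)))) =
      halfCauchy A₀ * ((∏ j, halfCauchy (A j)) * ∏ j, ∏ k, gaussianReal 0 1 (G j k)) := by
    simp only [Measure.prod_prod, Measure.pi_pi]
  rw [← h1, horseshoe]
  refine le_trans (measure_mono ?_) (Measure.le_map_apply (by fun_prop) _)
  rintro ⟨t, l, g⟩ ⟨ht, hl, hg⟩
  exact h t ht l (fun j => hl j trivial) g fun j k => hg j trivial k trivial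

/-- By Bernoulli's inequality the null rows together cost only a factor `1/2`; just the at most `s`
active rows pay the price `c`. -/
lemma half_mul_pow_le_prod_ite {m s : ℕ} (P : Fin m → Prop) [DecidablePred P] {x c : ℝ}
    (hx0 : 0 ≤ x) (hx1 : x ≤ 1) (hmx : m * x ≤ 1 / 2) (hc0 : 0 ≤ c) (hc1 : c ≤ 1)
    (hs : (Finset.univ.filter fun j => ¬ P j).card ≤ s) :
    1 / 2 * c ^ s ≤ ∏ j, if P j then 1 - x else c := by
  rw [Finset.prod_ite, Finset.prod_const, Finset.prod_const]
  have h1 : (1 - x) ^ m ≤ (1 - x) ^ (Finset.univ.filter fun j => P j).card :=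
    pow_le_pow_of_le_one (by linarith) (by linarith) (by simpa using Finset.card_filter_le Finset.univ P)
  have h2 : 1 + m * (-x) ≤ (1 + -x) ^ m := one_add_mul_le_pow (by linarith) m
  have h3 : c ^ s ≤ c ^ (Finset.univ.filter fun j => ¬ P j).card :=
    pow_le_pow_of_le_one hc0 hc1 hs
  rw [← sub_eq_add_neg] at h2
  have h4 : (1 : ℝ) / 2 ≤ (1 - x) ^ (Finset.univ.filter fun j => P j).card := by linarith
  exact mul_le_mul h4 h3 (by positivity) (by linarith)

lemma card_ne_zero_eq_rowSupport {m d : ℕ} (T : Rows m d) [DecidablePred fun j => T j = 0] :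
    (Finset.univ.filter fun j => ¬ T j = 0).card = rowSupport T := by
  rw [rowSupport, ← Set.ncard_coe_finset]
  congr 1
  ext j
  simp

/-- The density at height `L` is of order `L⁻²`, so a window of relative width `δ` has mass of order
`δ / L`, polynomial in `L`. The factor `W ^ 4 ≥ 16` absorbs numerical constants, which keeps all
later bounds pure powers of `W`. -/
lemma halfCauchy_Icc_ge_of_one_le {L δ W : ℝ} (hL : 1 ≤ L) (hδ0 : 0 ≤ δ) (hδ1 : δ ≤ 1) (hW : 2 ≤ W) :
    ENNReal.ofReal (δ / (L * W ^ 4)) ≤ halfCauchy (Set.Icc L (L * (1 + δ))) := by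
  refine le_trans (ENNReal.ofReal_le_ofReal ?_)
    (halfCauchy_Icc_ge (by linarith))
  have hpi := Real.pi_lt_four
  have hpi0 := Real.pi_pos
  have hW4 : (16 : ℝ) ≤ W ^ 4 := by
    calc (16 : ℝ) = 2 ^ 4 := by norm_num
      _ ≤ W ^ 4 := by gcongr
  have h1 : (L * (1 + δ)) ^ 2 ≤ 4 * L ^ 2 := by
    have : (1 + δ) ^ 2 ≤ 4 := by nlinarith
    rw [mul_pow]; nlinarith [sq_nonneg L]
  have h2 : Real.pi * (1 + (L * (1 + δ)) ^ 2) ≤ 20 * L ^ 2 := by nlinarith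
  have h3 : 1 / (10 * L ^ 2) ≤ 2 / (Real.pi * (1 + (L * (1 + δ)) ^ 2)) := by
    rw [div_le_div_iff₀ (by positivity) (by positivity)]; linarith
  calc δ / (L * W ^ 4) ≤ δ / (L * 10) := by gcongr; linarith
    _ = L * δ * (1 / (10 * L ^ 2)) := by field_simp
    _ ≤ L * δ * (2 / (Real.pi * (1 + (L * (1 + δ)) ^ 2))) := by gcongr
    _ = _ := by ring

lemma halfCauchy_Icc_ge_of_le_one {t δ W : ℝ} (ht : 0 < t) (ht1 : t ≤ 1) (hδ0 : 0 ≤ δ)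
    (hδ1 : δ ≤ 1) (hW : 2 ≤ W) :
    ENNReal.ofReal (t * δ / W ^ 4) ≤ halfCauchy (Set.Icc t (t * (1 + δ))) := by
  refine le_trans (ENNReal.ofReal_le_ofReal ?_)
    (halfCauchy_Icc_ge ht)
  have hpi := Real.pi_lt_four
  have hpi0 := Real.pi_pos
  have hW4 : (16 : ℝ) ≤ W ^ 4 := by
    calc (16 : ℝ) = 2 ^ 4 := by norm_num
      _ ≤ W ^ 4 := by gcongr
  have h1 : (t * (1 + δ)) ^ 2 ≤ 4 := by
    have h : t * (1 + δ) ≤ 2 := by nlinarith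
    have h' : 0 ≤ t * (1 + δ) := by positivity
    nlinarith
  have h3 : 1 / W ^ 4 ≤ 2 / (Real.pi * (1 + (t * (1 + δ)) ^ 2)) := by
    rw [div_le_div_iff₀ (by positivity) (by positivity)]; nlinarith
  calc t * δ / W ^ 4 = t * δ * (1 / W ^ 4) := by ring
    _ ≤ t * δ * (2 / (Real.pi * (1 + (t * (1 + δ)) ^ 2))) := by gcongr
    _ = _ := by ring

/-- An active entry is produced as scale times direction: the scales multiply to about `R`, and the
Gaussian factor only has to hit `T / R`, which lies in `[-1, 1]`. -/
lemma abs_scale_mul_sub_le {t l g T R τ Λ δ δ' : ℝ} (hτ : 0 < τ) (hΛ : 0 < Λ) (hR : τ * Λ = R)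
    (hδ0 : 0 ≤ δ) (hδ1 : δ ≤ 1) (hδ' : δ' ≤ 1) (hT : |T| ≤ R)
    (ht : t ∈ Set.Icc τ (τ * (1 + δ))) (hl : l ∈ Set.Icc Λ (Λ * (1 + δ)))
    (hg : g ∈ Set.Icc (T / R - δ') (T / R + δ')) :
    |l * t * g - T| ≤ R * (6 * δ + δ') := by
  have hR0 : 0 < R := by rw [← hR]; positivity
  have h1 : |g - T / R| ≤ δ' := abs_le.2 ⟨by linarith [hg.1], by linarith [hg.2]⟩
  have h2 : |T / R| ≤ 1 := by rw [abs_div, abs_of_pos hR0]; exact (div_le_one hR0).2 hT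
  have h3 : |g| ≤ 2 := by
    have := abs_add_le (g - T / R) (T / R)
    rw [sub_add_cancel] at this; linarith
  have h4 : |l * t - R| ≤ R * (3 * δ) := by
    rw [abs_le]
    have ha : τ * Λ ≤ l * t := by rw [mul_comm τ]; exact mul_le_mul hl.1 ht.1 hτ.le (hΛ.le.trans hl.1)
    have hb : l * t ≤ Λ * (1 + δ) * (τ * (1 + δ)) :=
      mul_le_mul hl.2 ht.2 (hτ.le.trans ht.1) (by positivity)
    have hc : Λ * (1 + δ) * (τ * (1 + δ)) = R * (1 + δ) ^ 2 := by rw [← hR]; ring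
    have hd : R * (1 + δ) ^ 2 ≤ R * (1 + 3 * δ) := by
      apply mul_le_mul_of_nonneg_left _ hR0.le; nlinarith
    have he : 0 ≤ R * (3 * δ) := by positivity
    constructor <;> nlinarith
  have h5 : l * t * g - T = (l * t - R) * g + R * (g - T / R) := by field_simp; ring
  rw [h5]
  calc _ ≤ |(l * t - R) * g| + |R * (g - T / R)| := abs_add_le _ _
    _ = |l * t - R| * |g| + R * |g - T / R| := by rw [abs_mul, abs_mul, abs_of_pos hR0]
    _ ≤ R * (3 * δ) * 2 + R * δ' := by gcongr
    _ = _ := by ring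

/-- Mass that the horseshoe law gives to a polynomially small sup-norm ball around a row-sparse
array with polynomially bounded entries. -/
lemma horseshoe_ball_ge (K : ℕ) {m d s : ℕ} {W : ℝ} (hW : 2 ≤ W) (hm : (m : ℝ) ≤ W) (hd : 1 ≤ d)
    (hdW : (d : ℝ) ≤ W ^ 2) (T : Rows m d) (hs : rowSupport T ≤ s)
    (hT : ∀ j k, |T j k| ≤ W ^ K) :
    ENNReal.ofReal ((W ^ ((6 * K + 20) * ((1 + s) * d)))⁻¹) ≤
      horseshoe m d {v | ∀ j k, |v j k - T j k| ≤ (W ^ K)⁻¹} := by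
  classical
  have hW0 : 0 < W := by linarith
  have hW1 : 1 ≤ W := by linarith
  have hpw : ∀ k : ℕ, 1 ≤ W ^ k := fun k => one_le_pow₀ hW1
  have hinv : ∀ k : ℕ, (W ^ k)⁻¹ ≤ 1 := fun k => inv_le_one_of_one_le₀ (hpw k)
  -- For a null row, `λ ≤ W ^ 2`, `t ≤ 2τ` and `|g| ≤ W ^ 3` give an entry of size at most `W ^ 6 τ
  -- = W⁻ᴷ`, the factor 2 being absorbed in `W`. For an active row, `τ Λ = W ^ K` dominates the
  -- entries of `T`, and `δ`, `δ'` make the error `W ^ K (6δ + δ')` at most `W⁻ᴷ`.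
  set τ : ℝ := (W ^ (K + 6))⁻¹ with hτ
  set Λ : ℝ := W ^ (2 * K + 6) with hΛ
  set δ : ℝ := (W ^ (2 * K + 4))⁻¹ with hδ
  set δ' : ℝ := (W ^ (2 * K + 1))⁻¹ with hδ'
  have hτ0 : 0 < τ := by positivity
  have hδ0 : 0 < δ := by positivity
  have hδ'0 : 0 < δ' := by positivity
  refine le_trans ?_ (horseshoe_ge_of_rectangle (A₀ := Set.Icc τ (τ * (1 + δ)))
    (A := fun j => if T j = 0 then Set.Ioc 0 (W ^ 2) else Set.Icc Λ (Λ * (1 + δ)))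
    (G := fun j k => if T j = 0 then Set.Ioo (-W ^ 3) (W ^ 3)
      else Set.Icc (T j k / W ^ K - δ') (T j k / W ^ K + δ')) ?_)
  · set c₁ : ℝ := (W ^ (4 * K + 14))⁻¹ with hc₁
    set c₂ : ℝ := (W ^ (2 * K + 5))⁻¹ with hc₂
    have hx₁ : 0 ≤ 1 - (W ^ 2)⁻¹ := by linarith [hinv 2]
    have hx₂ : 0 ≤ 1 - (W ^ 4)⁻¹ := by linarith [hinv 4]
    have hx₃ : 0 ≤ 1 - (W ^ 6)⁻¹ := by linarith [hinv 6]
    have e₁ : ENNReal.ofReal (1 / 2 * c₁ ^ s) ≤ ∏ j, halfCauchy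
        (if T j = 0 then Set.Ioc 0 (W ^ 2) else Set.Icc Λ (Λ * (1 + δ))) := by
      refine le_trans (ENNReal.ofReal_le_ofReal (half_mul_pow_le_prod_ite (fun j => T j = 0)
        (x := (W ^ 2)⁻¹) (by positivity) (hinv 2) ?_ (by positivity) (hinv _)
        (by rwa [card_ne_zero_eq_rowSupport]))) ?_
      · rw [← div_eq_mul_inv, div_le_div_iff₀ (by positivity) (by norm_num)]; nlinarith
      · rw [ENNReal.ofReal_prod_of_nonneg (fun j _ => by split_ifs <;> positivity)]
        refine Finset.prod_le_prod' fun j _ => ?_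
        split_ifs
        · simpa using halfCauchy_Ioc_ge (show (0 : ℝ) < W ^ 2 by positivity)
        · have h := halfCauchy_Icc_ge_of_one_le (hpw (2 * K + 6)) hδ0.le (hinv _) hW
          rwa [hδ, ← pow_add, div_eq_mul_inv, ← mul_inv, ← pow_add,
            show 2 * K + 4 + (2 * K + 6 + 4) = 4 * K + 14 by ring] at h
    have e₂ : ENNReal.ofReal (1 / 2 * (c₂ ^ d) ^ s) ≤ ∏ j, ∏ k, gaussianReal 0 1
        (if T j = 0 then Set.Ioo (-W ^ 3) (W ^ 3)
          else Set.Icc (T j k / W ^ K - δ') (T j k / W ^ K + δ')) := by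
      refine le_trans (ENNReal.ofReal_le_ofReal (half_mul_pow_le_prod_ite (fun j => T j = 0)
        (x := (W ^ 4)⁻¹) (by positivity) (hinv 4) ?_ (by positivity)
        (pow_le_one₀ (by positivity) (hinv _)) (by rwa [card_ne_zero_eq_rowSupport]))) ?_
      · rw [← div_eq_mul_inv, div_le_div_iff₀ (by positivity) (by norm_num)]
        nlinarith [hpw 2, sq_nonneg W]
      · rw [ENNReal.ofReal_prod_of_nonneg (fun j _ => by split_ifs <;> positivity)]
        refine Finset.prod_le_prod' fun j _ => ?_
        split_ifs
        · calc ENNReal.ofReal (1 - (W ^ 4)⁻¹) ≤ ENNReal.ofReal ((1 - (W ^ 6)⁻¹) ^ d) := by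
                apply ENNReal.ofReal_le_ofReal
                have := one_add_mul_le_pow (a := -(W ^ 6)⁻¹) (by linarith [hinv 6]) d
                rw [← sub_eq_add_neg] at this
                refine le_trans ?_ this
                have h6 : (W ^ 4)⁻¹ = W ^ 2 * (W ^ 6)⁻¹ := by field_simp
                have : (d : ℝ) * (W ^ 6)⁻¹ ≤ W ^ 2 * (W ^ 6)⁻¹ := by gcongr
                linarith
            _ = ∏ _k : Fin d, ENNReal.ofReal (1 - (W ^ 6)⁻¹) := by
                rw [Finset.prod_const, Finset.card_univ, Fintype.card_fin, ENNReal.ofReal_pow hx₃]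
            _ ≤ _ := by
                refine Finset.prod_le_prod' fun k _ => ?_
                have := gaussianReal_Ioo_ge (show (0 : ℝ) < W ^ 3 by positivity)
                rwa [← pow_mul, one_div] at this
        · rw [ENNReal.ofReal_pow (by positivity)]
          calc _ = ∏ _k : Fin d, ENNReal.ofReal c₂ := by
                rw [Finset.prod_const, Finset.card_univ, Fintype.card_fin]
            _ ≤ _ := by
                refine Finset.prod_le_prod' fun k _ => ?_
                refine le_trans (ENNReal.ofReal_le_ofReal ?_)
                  (gaussianReal_Icc_ge ?_ hδ'0.le (hinv _))
                · have h7 : c₂ = δ' * (W ^ 4)⁻¹ := by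
                    rw [hc₂, hδ', ← mul_inv, ← pow_add]
                  have h8 : (W ^ 4)⁻¹ ≤ 1 / 16 := by
                    rw [← one_div]
                    apply one_div_le_one_div_of_le (by norm_num)
                    calc (16 : ℝ) = 2 ^ 4 := by norm_num
                      _ ≤ W ^ 4 := by gcongr
                  rw [h7]; nlinarith
                · rw [abs_div, abs_of_pos (by positivity : 0 < W ^ K)]
                  exact (div_le_one (by positivity)).2 (hT j k)
    have e₀ : ENNReal.ofReal ((W ^ (3 * K + 14))⁻¹) ≤ halfCauchy (Set.Icc τ (τ * (1 + δ))) := by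
      have h := halfCauchy_Icc_ge_of_le_one hτ0 (hinv _) hδ0.le (hinv _) hW
      rwa [hτ, hδ, ← mul_inv, ← pow_add, div_eq_mul_inv, ← mul_inv, ← pow_add,
        show K + 6 + (2 * K + 4) + 4 = 3 * K + 14 by ring] at h
    refine le_trans ?_ (mul_le_mul' e₀ (mul_le_mul' e₁ e₂))
    rw [← ENNReal.ofReal_mul (by positivity), ← ENNReal.ofReal_mul (by positivity)]
    apply ENNReal.ofReal_le_ofReal
    -- Each factor `1/2` is traded for one power of `W`. The exponents then add up to less than `(6K
    -- + 20)(1 + s) d`, because `d ≥ 1`.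
    have h2 : (W ^ 1)⁻¹ ≤ 1 / 2 := by
      rw [pow_one, ← one_div]; exact one_div_le_one_div_of_le (by norm_num) hW
    have h3 : (W ^ (3 * K + 14 + (1 + (4 * K + 14) * s + (1 + (2 * K + 5) * (d * s)))))⁻¹ ≤
        (W ^ (3 * K + 14))⁻¹ * (1 / 2 * c₁ ^ s * (1 / 2 * (c₂ ^ d) ^ s)) := by
      rw [hc₁, hc₂, inv_pow, inv_pow, inv_pow, ← pow_mul, ← pow_mul, ← pow_mul]
      rw [pow_add W (3 * K + 14), pow_add W (1 + _), pow_add W 1, pow_add W 1, mul_inv, mul_inv,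
        mul_inv, mul_inv]
      gcongr
    refine le_trans ?_ h3
    apply inv_anti₀ (by positivity)
    apply pow_le_pow_right₀ hW1
    obtain ⟨e, rfl⟩ := Nat.exists_eq_add_of_le hd
    nlinarith [Nat.zero_le (K * e), Nat.zero_le (e * s), Nat.zero_le (K * e * s), Nat.zero_le s,
      Nat.zero_le (K * s)]
  · intro t ht l hl g hg j k
    specialize hl j
    specialize hg j k
    dsimp only at hl hg ⊢
    have hδ1 : δ ≤ 1 := hinv _
    split_ifs at hl hg with h0
    · have hl1 : |l j| ≤ W ^ 2 := by rw [abs_of_pos hl.1]; exact hl.2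
      have ht1 : |t| ≤ 2 * τ := by
        rw [abs_of_nonneg (hτ0.le.trans ht.1)]; nlinarith [ht.2]
      have hg1 : |g j k| ≤ W ^ 3 := (abs_lt.2 ⟨by simpa using hg.1, hg.2⟩).le
      rw [h0, Pi.zero_apply, sub_zero, abs_mul, abs_mul]
      calc _ ≤ W ^ 2 * (2 * τ) * W ^ 3 := by gcongr
        _ ≤ W ^ 2 * (W * τ) * W ^ 3 := by gcongr
        _ = (W ^ K)⁻¹ := by rw [hτ, pow_add]; field_simp
    · refine (abs_scale_mul_sub_le hτ0 (by positivity : 0 < Λ) ?_ hδ0.le hδ1 (hinv _) (hT j k)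
        ht hl hg).trans ?_
      · rw [hτ, hΛ]; rw [inv_mul_eq_div, div_eq_iff (by positivity), ← pow_add]; congr 1; ring
      · have h1 : δ = (W ^ (2 * K))⁻¹ * (W ^ 4)⁻¹ := by rw [hδ, pow_add, mul_inv]
        have h2 : δ' = (W ^ (2 * K))⁻¹ * W⁻¹ := by rw [hδ', pow_add, mul_inv, pow_one]
        have h3 : (W ^ K)⁻¹ = W ^ K * (W ^ (2 * K))⁻¹ * 1 := by
          rw [two_mul, pow_add]; field_simp
        have h4 : W⁻¹ ≤ 1 / 2 := by
          rw [← one_div]; exact one_div_le_one_div_of_le (by norm_num) hW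
        have h5 : (W ^ 4)⁻¹ ≤ 1 / 16 := by
          rw [← inv_pow]
          calc (W⁻¹) ^ 4 ≤ (1 / 2) ^ 4 := by gcongr
            _ = _ := by norm_num
        have h6 : 6 * δ + δ' = (W ^ (2 * K))⁻¹ * (6 * (W ^ 4)⁻¹ + W⁻¹) := by rw [h1, h2]; ring
        rw [h6, h3, ← mul_assoc]
        gcongr
        linarith

/-! ### The design matrix and the mass of the latent prior. -/

instance {n p : ℕ} (d : ℕ) (Z : Rows n p) : IsProbabilityMeasure (latentPrior d Z) :=
  Measure.isProbabilityMeasure_map (by unfold fitted; fun_prop)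

lemma norm21_nonneg {m d : ℕ} (A : Rows m d) : 0 ≤ norm21 A :=
  Finset.sum_nonneg fun _ _ => Real.sqrt_nonneg _

lemma norm21_smul {m d : ℕ} {t : ℝ} (ht : 0 ≤ t) (A : Rows m d) : norm21 (t • A) = t * norm21 A := by
  simp only [norm21, Finset.mul_sum, Pi.smul_apply, smul_eq_mul, mul_pow]
  refine Finset.sum_congr rfl fun i _ => ?_
  rw [← Finset.mul_sum, Real.sqrt_mul (by positivity), Real.sqrt_sq ht]

lemma frobSq_smul {m d : ℕ} (t : ℝ) (A : Rows m d) : frobSq (t • A) = t ^ 2 * frobSq A := by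
  simp only [frobSq, Finset.mul_sum, Pi.smul_apply, smul_eq_mul, mul_pow]

lemma fitted_smul {n p d : ℕ} (Z : Rows n p) (t : ℝ) (B : Rows p d) :
    fitted Z (t • B) = t • fitted Z B := by
  ext i k
  simp only [fitted, Finset.mul_sum, Pi.smul_apply, smul_eq_mul]
  exact Finset.sum_congr rfl fun _ _ => by ring

lemma fitted_sub {n p d : ℕ} (Z : Rows n p) (A B : Rows p d) :
    fitted Z (A - B) = fitted Z A - fitted Z B := by
  ext i k
  simp only [fitted, Pi.sub_apply, ← Finset.sum_sub_distrib, mul_sub]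

/-- By homogeneity the restriction on the `ℓ_{2,1}` norm can be dropped. -/
lemma RestrictedUpperEigenvalue.frobSq_fitted_le {n p d sb : ℕ} {C c : ℝ} {Z : Rows n p}
    (h : RestrictedUpperEigenvalue d sb C c Z)
    (hpos : 0 < C * (max sb 1 : ℕ) * d * Real.log (n * p)) (B : Rows p d) :
    frobSq (fitted Z B) ≤ c * n * frobSq B := by
  set b := C * (max sb 1 : ℕ) * d * Real.log (n * p)
  have hB := norm21_nonneg B
  have ht : 0 < b / (norm21 B + 1) := by positivity
  have h1 := h ((b / (norm21 B + 1)) • B) (by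
    rw [norm21_smul ht.le, div_mul_eq_mul_div, div_le_iff₀ (by positivity)]
    nlinarith)
  rw [fitted_smul, frobSq_smul, frobSq_smul] at h1
  have h2 := pow_pos ht 2
  refine le_of_mul_le_mul_left ?_ h2
  linarith

lemma sq_le_frobSq {m d : ℕ} (A : Rows m d) (i : Fin m) (k : Fin d) : A i k ^ 2 ≤ frobSq A :=
  (Finset.single_le_sum (f := fun k => A i k ^ 2) (fun _ _ => sq_nonneg _) (Finset.mem_univ k)).trans
    (Finset.single_le_sum (f := fun i => ∑ k, A i k ^ 2)
      (fun _ _ => Finset.sum_nonneg fun _ _ => sq_nonneg _) (Finset.mem_univ i))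

lemma frobSq_le {m d : ℕ} {A : Rows m d} {R : ℝ} (h : ∀ i k, |A i k| ≤ R) :
    frobSq A ≤ m * (d * R ^ 2) := by
  calc frobSq A ≤ ∑ _i : Fin m, ∑ _k : Fin d, R ^ 2 :=
        Finset.sum_le_sum fun i _ => Finset.sum_le_sum fun k _ =>
          sq_le_sq' (by linarith [(abs_le.1 (h i k)).1]) (abs_le.1 (h i k)).2
    _ = _ := by simp

/-- An entry is bounded by the Frobenius norm. The loss of `W ^ 2` is harmless, as horseshoe balls
may have any polynomially small radius. -/
lemma abs_fitted_le {n p d : ℕ} {Z : Rows n p} {c W R : ℝ} (hc : 0 ≤ c)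
    (hZ : ∀ B : Rows p d, frobSq (fitted Z B) ≤ c * n * frobSq B)
    (hW : (n : ℝ) * p = W) (hcW : c ≤ W) (hd : (d : ℝ) ≤ W ^ 2) (hR : 0 ≤ R) {B : Rows p d}
    (hB : ∀ j k, |B j k| ≤ R) (i : Fin n) (k : Fin d) : |fitted Z B i k| ≤ W ^ 2 * R := by
  have hW0 : 0 ≤ W := by rw [← hW]; positivity
  apply abs_le_of_sq_le_sq _ (by positivity)
  calc fitted Z B i k ^ 2 ≤ frobSq (fitted Z B) := sq_le_frobSq _ _ _
    _ ≤ c * n * frobSq B := hZ B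
    _ ≤ c * n * (p * (d * R ^ 2)) := by gcongr; exact frobSq_le hB
    _ = c * (n * p) * d * R ^ 2 := by ring
    _ ≤ W * W * W ^ 2 * R ^ 2 := by rw [hW]; gcongr
    _ = _ := by ring

/-- Mass that the latent prior gives to a small sup-norm ball around a structured array. -/
lemma latentPrior_ball_ge (K : ℕ) (hK : 8 ≤ K) {n p d sb sx : ℕ} {Z : Rows n p} {c W : ℝ}
    (hc : 0 ≤ c) (hZ : ∀ B : Rows p d, frobSq (fitted Z B) ≤ c * n * frobSq B)
    (hn : 1 ≤ n) (hp : 1 ≤ p) (hd : 1 ≤ d) (hW : (n : ℝ) * p = W) (hW2 : 2 ≤ W) (hcW : c ≤ W)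
    (hdW : (d : ℝ) ≤ W ^ 2) {B : Rows p d} {X : Rows n d}
    (hsb : rowSupport B ≤ sb) (hsx : rowSupport (X - fitted Z B) ≤ sx)
    (hB : ∀ j k, |B j k| ≤ W ^ K) (hX : ∀ i k, |X i k - fitted Z B i k| ≤ W ^ K) :
    ENNReal.ofReal ((W ^ ((6 * K + 20) * (2 * (1 + sb + sx) * d)))⁻¹) ≤
      latentPrior d Z {x | ∀ i k, |x i k - X i k| ≤ (W ^ 5)⁻¹} := by
  have hW1 : 1 ≤ W := by linarith
  have hW0 : 0 < W := by linarith
  have hnR : (1 : ℝ) ≤ n := by exact_mod_cast hn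
  have hpR : (1 : ℝ) ≤ p := by exact_mod_cast hp
  have hb := horseshoe_ball_ge K hW2 (m := p) (by nlinarith) hd hdW B hsb hB
  have hx := horseshoe_ball_ge K hW2 (m := n) (by nlinarith) hd hdW _ hsx hX
  calc _ ≤ ENNReal.ofReal ((W ^ ((6 * K + 20) * ((1 + sb) * d)))⁻¹) *
        ENNReal.ofReal ((W ^ ((6 * K + 20) * ((1 + sx) * d)))⁻¹) := by
        rw [← ENNReal.ofReal_mul (by positivity), ← mul_inv, ← pow_add]
        apply ENNReal.ofReal_le_ofReal
        apply inv_anti₀ (by positivity)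
        apply pow_le_pow_right₀ hW1
        rw [← mul_add, ← add_mul]
        gcongr
        omega
    _ ≤ _ := mul_le_mul' hb hx
    _ = ((horseshoe p d).prod (horseshoe n d)) _ := (Measure.prod_prod _ _).symm
    _ ≤ _ := by
        refine le_trans (measure_mono ?_)
          (Measure.le_map_apply (by unfold fitted; fun_prop) _)
        rintro ⟨b, v⟩ ⟨h1, h2⟩ i k
        have h3 := abs_fitted_le hc hZ hW hcW hdW (R := (W ^ K)⁻¹) (by positivity) (B := b - B)
          (fun j k => h1 j k) i k
        have h4 : |v i k - (X - fitted Z B) i k| ≤ (W ^ K)⁻¹ := h2 i k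
        have h5 : (fitted Z b + v) i k - X i k =
            fitted Z (b - B) i k + (v i k - (X - fitted Z B) i k) := by
          rw [fitted_sub]; simp only [Pi.add_apply, Pi.sub_apply]; ring
        change |(fitted Z b + v) i k - X i k| ≤ _
        rw [h5]
        refine (abs_add_le _ _).trans ((add_le_add h3 h4).trans ?_)
        -- The condition `K ≥ 8` enters here: `(W ^ 2 + 1) W⁻⁸ ≤ W⁻⁵`.
        obtain ⟨e, rfl⟩ := Nat.exists_eq_add_of_le hK
        have h6 : (W ^ (8 + e))⁻¹ ≤ (W ^ 8)⁻¹ := by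
          apply inv_anti₀ (by positivity); exact pow_le_pow_right₀ hW1 (by omega)
        calc _ = (W ^ 2 + 1) * (W ^ (8 + e))⁻¹ := by ring
          _ ≤ W ^ 3 * (W ^ 8)⁻¹ := by gcongr; nlinarith
          _ = _ := by field_simp

/-! ### Lower bounds for likelihood ratios. -/

/-- Exponential tilting: `1 + σ(t)(e^Δ - 1)` is the moment generating function at `Δ` of a Bernoulli
variable with mean `σ(t)`, and shifting the natural parameter by `Δ` tilts the law. -/
lemma sigmoid_add_mul (t Δ : ℝ) :
    Real.sigmoid (t + Δ) * (1 + Real.sigmoid t * (Real.exp Δ - 1)) = Real.sigmoid t * Real.exp Δ := by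
  have h1 : 0 < 1 + Real.exp (-t) := by positivity
  have h2 : 0 < 1 + Real.exp (-(t + Δ)) := by positivity
  have h3 : Real.exp (-(t + Δ)) * Real.exp Δ = Real.exp (-t) := by
    rw [← Real.exp_add]; congr 1; ring
  simp only [Real.sigmoid_def]
  field_simp
  linear_combination -h3

lemma one_add_sigmoid_mul_le {t Δ : ℝ} (hΔ : |Δ| ≤ 1) :
    1 + Real.sigmoid t * (Real.exp Δ - 1) ≤ Real.exp (Real.sigmoid t * Δ + Δ ^ 2) := by
  have h1 := Real.add_one_le_exp (Real.sigmoid t * (Real.exp Δ - 1))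
  have h2 := (abs_le.1 (Real.abs_exp_sub_one_sub_id_le hΔ)).2
  have h3 := Real.sigmoid_nonneg t
  have h4 := Real.sigmoid_le_one t
  calc _ ≤ Real.exp (Real.sigmoid t * (Real.exp Δ - 1)) := by linarith
    _ ≤ _ := Real.exp_le_exp.2 (by nlinarith [sq_nonneg Δ])

lemma one_add_sigmoid_mul_pos (t Δ : ℝ) : 0 < 1 + Real.sigmoid t * (Real.exp Δ - 1) := by
  nlinarith [Real.sigmoid_pos t, Real.sigmoid_lt_one t, Real.exp_pos Δ,
    mul_pos (Real.sigmoid_pos t) (Real.exp_pos Δ)]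

/-- Probability of the outcome `b` of a Bernoulli trial with natural parameter `t`. -/
noncomputable def bernoulliLogistic (b : Bool) (t : ℝ) : ℝ :=
  if b then Real.sigmoid t else 1 - Real.sigmoid t

/-- Centred indicator of the outcome `true` of a Bernoulli trial with natural parameter `t`. -/
noncomputable def bernoulliScore (b : Bool) (t : ℝ) : ℝ := (if b then 1 else 0) - Real.sigmoid t

lemma bernoulliLogistic_pos (b : Bool) (t : ℝ) : 0 < bernoulliLogistic b t := by
  rw [bernoulliLogistic]
  split_ifs
  · exact Real.sigmoid_pos t
  · linarith [Real.sigmoid_lt_one t]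

lemma abs_bernoulliScore_le_one (b : Bool) (t : ℝ) : |bernoulliScore b t| ≤ 1 := by
  have h3 := Real.sigmoid_nonneg t
  have h4 := Real.sigmoid_le_one t
  rw [bernoulliScore, abs_le]
  split_ifs <;> constructor <;> linarith

lemma bernoulliLogistic_add_ge (b : Bool) {t Δ : ℝ} (hΔ : |Δ| ≤ 1) :
    bernoulliLogistic b t * Real.exp (bernoulliScore b t * Δ - Δ ^ 2) ≤
      bernoulliLogistic b (t + Δ) := by
  have h0 := one_add_sigmoid_mul_pos t Δ
  have h1 := sigmoid_add_mul t Δ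
  have h2 := one_add_sigmoid_mul_le (t := t) hΔ
  have h3 : bernoulliLogistic b (t + Δ) * (1 + Real.sigmoid t * (Real.exp Δ - 1)) =
      bernoulliLogistic b t * Real.exp ((if b then 1 else 0) * Δ) := by
    cases b
    · simp only [bernoulliLogistic, Bool.false_eq_true, if_false, zero_mul, Real.exp_zero]
      linarith
    · simpa [bernoulliLogistic] using h1
  have h4 := bernoulliLogistic_pos b t
  rw [← mul_le_mul_iff_left₀ h0, h3]
  calc _ ≤ bernoulliLogistic b t * Real.exp (bernoulliScore b t * Δ - Δ ^ 2) *
        Real.exp (Real.sigmoid t * Δ + Δ ^ 2) := by gcongr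
    _ = _ := by
      rw [mul_assoc, ← Real.exp_add, bernoulliScore]; congr 2; ring

lemma likelihood_eq_prod {n d : ℕ} (X : Rows n d) (β : ℝ) (y : Network n) :
    likelihood X β y = ∏ q, bernoulliLogistic (y q) (logit X β q) := rfl

lemma likelihood_pos {n d : ℕ} (X : Rows n d) (β : ℝ) (y : Network n) : 0 < likelihood X β y :=
  Finset.prod_pos fun _ _ => bernoulliLogistic_pos _ _

/-- Derivative of the log-likelihood in the sparsity parameter. -/
noncomputable def totalScore {n d : ℕ} (X : Rows n d) (β : ℝ) (y : Network n) : ℝ :=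
  ∑ q, bernoulliScore (y q) (logit X β q)

lemma card_pairs_le (n : ℕ) : (Fintype.card (Pairs n) : ℝ) ≤ (n : ℝ) ^ 2 := by
  have := Fintype.card_subtype_le fun q : Fin n × Fin n => q.1 ≤ q.2
  simp only [Fintype.card_prod, Fintype.card_fin] at this
  rw [sq]
  exact_mod_cast this

/-- The common shift `β' - β` multiplies the total score, where cancellation is exploited. The rest
of each logit shift is at most `e` and is bounded term by term, so the only condition on the data
does not involve `(X', β')`. -/
lemma likelihood_ge {n d : ℕ} {X X' : Rows n d} {β β' b e s : ℝ} {y : Network n}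
    (hb : |β' - β| ≤ b) (he : ∀ q, |logit X' β' q - logit X β q - (β' - β)| ≤ e) (he0 : 0 ≤ e)
    (hbe : b + e ≤ 1) (hs : |totalScore X β y| ≤ s) :
    likelihood X β y * Real.exp (-(b * s + n ^ 2 * e + n ^ 2 * (b + e) ^ 2)) ≤
      likelihood X' β' y := by
  set Δ : Pairs n → ℝ := fun q => logit X' β' q - logit X β q with hΔ
  have hb0 : 0 ≤ b := (abs_nonneg _).trans hb
  have hΔ1 : ∀ q, |Δ q| ≤ b + e := fun q => by
    have h := abs_add_le (β' - β) (logit X' β' q - logit X β q - (β' - β))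
    rw [add_sub_cancel] at h
    exact h.trans (add_le_add hb (he q))
  have hprod : likelihood X β y *
      Real.exp (∑ q, (bernoulliScore (y q) (logit X β q) * Δ q - Δ q ^ 2)) ≤
      likelihood X' β' y := by
    rw [likelihood_eq_prod, likelihood_eq_prod, Real.exp_sum, ← Finset.prod_mul_distrib]
    refine Finset.prod_le_prod
      (fun q _ => mul_nonneg (bernoulliLogistic_pos _ _).le (Real.exp_pos _).le) fun q _ => ?_
    have h := bernoulliLogistic_add_ge (y q) (t := logit X β q) ((hΔ1 q).trans hbe)
    rwa [show logit X β q + Δ q = logit X' β' q by simp [hΔ]] at h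
  refine le_trans (mul_le_mul_of_nonneg_left (Real.exp_le_exp.2 ?_) (likelihood_pos _ _ _).le) hprod
  have hcard := card_pairs_le n
  have hdec : ∑ q, (bernoulliScore (y q) (logit X β q) * Δ q - Δ q ^ 2) =
      (β' - β) * totalScore X β y +
        ∑ q, (bernoulliScore (y q) (logit X β q) * (Δ q - (β' - β)) - Δ q ^ 2) := by
    rw [totalScore, Finset.mul_sum, ← Finset.sum_add_distrib]
    exact Finset.sum_congr rfl fun _ _ => by ring
  have h1 : -(b * s) ≤ (β' - β) * totalScore X β y := by
    have : |(β' - β) * totalScore X β y| ≤ b * s := by rw [abs_mul]; gcongr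
    exact (abs_le.1 this).1
  have h2 : ∑ _q : Pairs n, (-(e + (b + e) ^ 2)) ≤
      ∑ q, (bernoulliScore (y q) (logit X β q) * (Δ q - (β' - β)) - Δ q ^ 2) := by
    refine Finset.sum_le_sum fun q _ => ?_
    have h3 : |bernoulliScore (y q) (logit X β q) * (Δ q - (β' - β))| ≤ 1 * e := by
      rw [abs_mul]
      exact mul_le_mul (abs_bernoulliScore_le_one _ _) (he q) (abs_nonneg _) zero_le_one
    have h4 : Δ q ^ 2 ≤ (b + e) ^ 2 := sq_le_sq' (abs_le.1 (hΔ1 q)).1 (abs_le.1 (hΔ1 q)).2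
    linarith [(abs_le.1 h3).1]
  rw [Finset.sum_const, Finset.card_univ, nsmul_eq_mul] at h2
  have h5 : (Fintype.card (Pairs n) : ℝ) * (e + (b + e) ^ 2) ≤ n ^ 2 * (e + (b + e) ^ 2) := by
    gcongr
  rw [hdec]
  linarith

lemma abs_logit_sub_sub_le {n d : ℕ} {X X' : Rows n d} {β β' C ρ : ℝ} (hX : ∀ i k, |X i k| ≤ C)
    (h : ∀ i k, |X' i k - X i k| ≤ ρ) (q : Pairs n) :
    |logit X' β' q - logit X β q - (β' - β)| ≤ d * (2 * C * ρ + ρ ^ 2) := by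
  have h1 : logit X' β' q - logit X β q - (β' - β) =
      ∑ k, (X' q.1.1 k * X' q.1.2 k - X q.1.1 k * X q.1.2 k) := by
    rw [logit, logit, Finset.sum_sub_distrib]; ring
  rw [h1]
  calc _ ≤ ∑ k, |X' q.1.1 k * X' q.1.2 k - X q.1.1 k * X q.1.2 k| := Finset.abs_sum_le_sum_abs _ _
    _ ≤ ∑ _k : Fin d, (2 * C * ρ + ρ ^ 2) := by
        refine Finset.sum_le_sum fun k _ => ?_
        have ha := hX q.1.1 k
        have hb := hX q.1.2 k
        have hc := h q.1.1 k
        have hd := h q.1.2 k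
        have hC : 0 ≤ C := (abs_nonneg _).trans ha
        have hρ : 0 ≤ ρ := (abs_nonneg _).trans hc
        generalize X q.1.1 k = a at *
        generalize X q.1.2 k = b at *
        generalize X' q.1.1 k = a' at *
        generalize X' q.1.2 k = b' at *
        have e : a' * b' - a * b = (a' - a) * b + a * (b' - b) + (a' - a) * (b' - b) := by ring
        rw [e]
        calc _ ≤ |(a' - a) * b| + |a * (b' - b)| + |(a' - a) * (b' - b)| := abs_add_three _ _ _
          _ ≤ ρ * C + C * ρ + ρ * ρ := by
              simp only [abs_mul]; gcongr
          _ = _ := by ring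
    _ = _ := by rw [Finset.sum_const, Finset.card_univ, Fintype.card_fin, nsmul_eq_mul]

/-! ### The law of the network and the fluctuation of the score. -/

instance {n d : ℕ} (X : Rows n d) (β : ℝ) : IsProbabilityMeasure (dataLaw X β) := by
  unfold dataLaw; infer_instance

lemma dataLaw_singleton {n d : ℕ} (X : Rows n d) (β : ℝ) (y : Network n) :
    dataLaw X β {y} = ENNReal.ofReal (likelihood X β y) := by
  rw [dataLaw, Measure.pi_singleton, likelihood_eq_prod,
    ENNReal.ofReal_prod_of_nonneg fun q _ => (bernoulliLogistic_pos _ _).le]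
  refine Finset.prod_congr rfl fun q _ => ?_
  have hs : ((unitInterval.sigmoid (logit X β q) : unitInterval) : ℝ) =
    Real.sigmoid (logit X β q) := rfl
  cases hq : y q
  · rw [bernoulliMeasure_apply_of_notMem_of_mem _ (measurableSet_singleton _) (by simp) (by simp)]
    rw [bernoulliLogistic, if_neg (by simp), ← hs, ← ENNReal.ofReal_coe_nnreal]
    simp
  · rw [bernoulliMeasure_apply_of_mem_of_notMem _ (measurableSet_singleton _) (by simp) (by simp)]
    rw [bernoulliLogistic, if_pos rfl, ← hs, ← ENNReal.ofReal_coe_nnreal]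
    simp

/-- Chebyshev's inequality: at most `n ^ 2` independent centred terms, each of variance at most
`1/4` whatever the parameters. -/
lemma dataLaw_totalScore_le {n d : ℕ} (X : Rows n d) (β : ℝ) {s : ℝ} (hs : 0 < s) :
    dataLaw X β {y | s ≤ |totalScore X β y|} ≤ ENNReal.ofReal ((n : ℝ) ^ 2 / (4 * s ^ 2)) := by
  have hLp : ∀ q : Pairs n, MemLp (fun b : Bool => bernoulliScore b (logit X β q)) 2
      (bernoulliMeasure true false (unitInterval.sigmoid (logit X β q))) := fun q =>
    MemLp.of_bound (measurable_of_finite _).aestronglyMeasurable 1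
      (ae_of_all _ fun b => abs_bernoulliScore_le_one _ _)
  have hmean : ∫ y, totalScore X β y ∂(dataLaw X β) = 0 := by
    simp only [totalScore]
    rw [integral_finsetSum _ fun q _ => Integrable.of_finite]
    refine Finset.sum_eq_zero fun q _ => ?_
    rw [dataLaw, integral_comp_eval (μ := fun q : Pairs n => bernoulliMeasure true false
      (unitInterval.sigmoid (logit X β q))) (f := fun b => bernoulliScore b (logit X β q))
      (measurable_of_finite _).aestronglyMeasurable, integral_bernoulliMeasure]
    simp only [bernoulliScore, if_true, Bool.false_eq_true, if_false, smul_eq_mul]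
    change Real.sigmoid _ * _ + (1 - Real.sigmoid _) * _ = 0
    ring
  have hvar : Var[totalScore X β; dataLaw X β] ≤ (n : ℝ) ^ 2 / 4 := by
    have h1 := variance_sum_pi hLp
    have h2 : (∑ q, fun ω : Network n => bernoulliScore (ω q) (logit X β q)) = totalScore X β := by
      ext y; simp [totalScore]
    rw [h2] at h1
    rw [dataLaw, h1]
    calc _ ≤ ∑ _q : Pairs n, (1 : ℝ) / 4 := Finset.sum_le_sum fun q _ => by
          refine (variance_le_sq_of_bounded (a := -Real.sigmoid (logit X β q))
            (b := 1 - Real.sigmoid (logit X β q)) (ae_of_all _ fun b => ?_)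
            (measurable_of_finite _).aemeasurable).trans (by norm_num)
          cases b <;> simp [bernoulliScore]
      _ ≤ _ := by
          have := card_pairs_le n
          simp only [Finset.sum_const, Finset.card_univ, nsmul_eq_mul]
          linarith
  have h := meas_ge_le_variance_div_sq (μ := dataLaw X β) (X := totalScore X β)
    (MemLp.of_bound (measurable_of_finite _).aestronglyMeasurable (∑ _q : Pairs n, (1 : ℝ))
      (ae_of_all _ fun y => (Finset.abs_sum_le_sum_abs _ _).trans
        (Finset.sum_le_sum fun q _ => abs_bernoulliScore_le_one _ _))) hs
  rw [hmean] at h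
  simp only [sub_zero] at h
  refine h.trans (ENNReal.ofReal_le_ofReal ?_)
  rw [← div_div]
  gcongr

/-! ### Numerator and denominator of the fractional posterior. -/

instance {n p : ℕ} (d : ℕ) (Z : Rows n p) (πβ : Measure ℝ) [IsProbabilityMeasure πβ] :
    IsProbabilityMeasure (prior d Z πβ) := by
  unfold prior; infer_instance

@[fun_prop]
lemma measurable_likelihood {n d : ℕ} (y : Network n) :
    Measurable fun w : Rows n d × ℝ => likelihood w.1 w.2 y := by
  have hs : Measurable Real.sigmoid := continuous_sigmoid.measurable
  unfold likelihood logit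
  refine Finset.measurable_prod _ fun q _ => ?_
  split_ifs <;> fun_prop

lemma measurable_renyi_likelihood {n d : ℕ} (α : ℝ) (f : Network n → ℝ) :
    Measurable fun w : Rows n d × ℝ => renyi α (likelihood w.1 w.2) f := by
  unfold renyi
  fun_prop

lemma sum_rpow_mul_rpow_le_exp_of_le_renyi {Ω : Type*} [Fintype Ω] [Nonempty Ω] {α r : ℝ}
    (hα : α < 1) {f g : Ω → ℝ} (hf : ∀ y, 0 < f y) (hg : ∀ y, 0 < g y) (h : r ≤ renyi α f g) :
    ∑ y, f y ^ α * g y ^ (1 - α) ≤ Real.exp (-((1 - α) * r)) := by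
  have hpos : 0 < ∑ y, f y ^ α * g y ^ (1 - α) :=
    Finset.sum_pos (fun y _ => mul_pos (Real.rpow_pos_of_pos (hf y) _)
      (Real.rpow_pos_of_pos (hg y) _)) Finset.univ_nonempty
  rw [← Real.log_le_iff_le_exp hpos]
  rw [renyi] at h
  set l := Real.log (∑ y, f y ^ α * g y ^ (1 - α))
  have h1 : 0 < 1 - α := by linarith
  have h2 : 1 / (α - 1) * l = -(l / (1 - α)) := by
    rw [show α - 1 = -(1 - α) by ring, one_div, inv_neg]; ring
  rw [h2, le_neg, div_le_iff₀ h1] at h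
  linarith

/-- Markov bound for the posterior numerator over a set on which the Rényi divergence is large. -/
lemma dataLaw_numerator_le {n d : ℕ} (μ : Measure (Rows n d × ℝ)) [IsProbabilityMeasure μ]
    {α r c : ℝ} (hα : α < 1) (hc : 0 < c) (X : Rows n d) (β : ℝ) {U : Set (Rows n d × ℝ)}
    (hr : ∀ w ∈ U, r ≤ renyi α (likelihood w.1 w.2) (likelihood X β)) :
    dataLaw X β {y | ENNReal.ofReal (likelihood X β y ^ α * c) ≤
        ∫⁻ w in U, ENNReal.ofReal (likelihood w.1 w.2 y ^ α) ∂μ} ≤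
      ENNReal.ofReal (Real.exp (-((1 - α) * r)) / c) := by
  have hf := likelihood_pos X β
  set g : Network n → ENNReal := fun y =>
    ENNReal.ofReal (likelihood X β y ^ (-α)) *
      ∫⁻ w in U, ENNReal.ofReal (likelihood w.1 w.2 y ^ α) ∂μ with hg
  have hint : ∫⁻ y, g y ∂(dataLaw X β) ≤ ENNReal.ofReal (Real.exp (-((1 - α) * r))) := by
    calc ∫⁻ y, g y ∂(dataLaw X β)
        = ∑ y, ∫⁻ w in U, ENNReal.ofReal
            (likelihood w.1 w.2 y ^ α * likelihood X β y ^ (1 - α)) ∂μ := by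
          rw [lintegral_fintype]
          refine Finset.sum_congr rfl fun y _ => ?_
          rw [dataLaw_singleton, hg, mul_comm, ← mul_assoc, ← ENNReal.ofReal_mul (hf y).le,
            ← lintegral_const_mul _ (by fun_prop)]
          refine lintegral_congr fun w => ?_
          rw [← ENNReal.ofReal_mul (mul_nonneg (hf y).le (Real.rpow_nonneg (hf y).le _)),
            sub_eq_add_neg, Real.rpow_add (hf y), Real.rpow_one]
          congr 1; ring
      _ = ∫⁻ w in U, ENNReal.ofReal
            (∑ y, likelihood w.1 w.2 y ^ α * likelihood X β y ^ (1 - α)) ∂μ := by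
          rw [← lintegral_finsetSum _ fun y _ => by fun_prop]
          refine lintegral_congr fun w => ?_
          rw [ENNReal.ofReal_sum_of_nonneg fun y _ => mul_nonneg
            (Real.rpow_nonneg (likelihood_pos _ _ _).le _) (Real.rpow_nonneg (hf y).le _)]
      _ ≤ ∫⁻ _w in U, ENNReal.ofReal (Real.exp (-((1 - α) * r))) ∂μ := by
          refine setLIntegral_mono measurable_const fun w hw => ENNReal.ofReal_le_ofReal ?_
          exact sum_rpow_mul_rpow_le_exp_of_le_renyi hα (likelihood_pos _ _) hf (hr w hw)
      _ ≤ ENNReal.ofReal (Real.exp (-((1 - α) * r))) * 1 := by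
          rw [setLIntegral_const]; gcongr; exact prob_le_one
      _ = _ := mul_one _
  have hmark := meas_ge_le_lintegral_div (μ := dataLaw X β) (f := g)
    (measurable_of_finite g).aemeasurable (ε := ENNReal.ofReal c)
    (by simpa using hc) ENNReal.ofReal_ne_top
  rw [ENNReal.ofReal_div_of_pos hc]
  refine le_trans (measure_mono fun y hy => ?_) (hmark.trans (ENNReal.div_le_div_right hint _))
  change ENNReal.ofReal c ≤ g y
  have hy' : ENNReal.ofReal (likelihood X β y ^ α * c) ≤
    ∫⁻ w in U, ENNReal.ofReal (likelihood w.1 w.2 y ^ α) ∂μ := hy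
  calc ENNReal.ofReal c = ENNReal.ofReal (likelihood X β y ^ (-α)) *
        ENNReal.ofReal (likelihood X β y ^ α * c) := by
        rw [← ENNReal.ofReal_mul (Real.rpow_nonneg (hf y).le _), ← mul_assoc,
          ← Real.rpow_add (hf y), neg_add_cancel, Real.rpow_zero, one_mul]
    _ ≤ g y := mul_le_mul' le_rfl hy'

/-- The integral is restricted to `V`; since `α ≤ 1` and `x ≥ 0`, the loss `e^{-αx}` is no worse
than `e^{-x}`. -/
lemma denominator_ge {n d : ℕ} (μ : Measure (Rows n d × ℝ)) {α x m : ℝ} (hα0 : 0 ≤ α)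
    (hα : α ≤ 1) (hx : 0 ≤ x) {X : Rows n d} {β : ℝ} {V : Set (Rows n d × ℝ)}
    (hV : ENNReal.ofReal m ≤ μ V) {y : Network n}
    (h : ∀ w ∈ V, likelihood X β y * Real.exp (-x) ≤ likelihood w.1 w.2 y) :
    ENNReal.ofReal (likelihood X β y ^ α * (Real.exp (-x) * m)) ≤
      ∫⁻ w, ENNReal.ofReal (likelihood w.1 w.2 y ^ α) ∂μ := by
  have hf := likelihood_pos X β y
  have hfα : 0 ≤ likelihood X β y ^ α := Real.rpow_nonneg hf.le _
  rw [← mul_assoc, ENNReal.ofReal_mul (by positivity)]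
  calc _ ≤ ENNReal.ofReal (likelihood X β y ^ α * Real.exp (-x)) * μ V := by gcongr
    _ = ∫⁻ _w in V, ENNReal.ofReal (likelihood X β y ^ α * Real.exp (-x)) ∂μ := by
        rw [setLIntegral_const]
    _ ≤ ∫⁻ w in V, ENNReal.ofReal (likelihood w.1 w.2 y ^ α) ∂μ := by
        refine setLIntegral_mono (by fun_prop) fun w hw => ENNReal.ofReal_le_ofReal ?_
        calc _ ≤ likelihood X β y ^ α * Real.exp (-x) ^ α := by
              gcongr
              rw [← Real.exp_mul]
              exact Real.exp_le_exp.2 (by nlinarith)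
          _ = (likelihood X β y * Real.exp (-x)) ^ α :=
              (Real.mul_rpow hf.le (Real.exp_pos _).le).symm
          _ ≤ _ := Real.rpow_le_rpow (by positivity) (h w hw) hα0
    _ ≤ _ := setLIntegral_le_lintegral _ _

/-- Concentration of the fractional posterior, given the prior mass of a set on which the
likelihood ratio is bounded below. -/
lemma dataLaw_fracPosterior_le_ge {n p d : ℕ} (Z : Rows n p) (πβ : Measure ℝ)
    [IsProbabilityMeasure πβ] {α r c x m s : ℝ} (hα0 : 0 ≤ α) (hα : α < 1) (hc : 0 < c)
    (hx : 0 ≤ x) (hm : 0 < m) (hs : 0 < s) (X : Rows n d) (β : ℝ) {U V : Set (Rows n d × ℝ)}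
    (hU : MeasurableSet U) (hr : ∀ w ∈ U, r ≤ renyi α (likelihood w.1 w.2) (likelihood X β))
    (hV : ENNReal.ofReal m ≤ prior d Z πβ V)
    (h : ∀ y, |totalScore X β y| ≤ s → ∀ w ∈ V,
      likelihood X β y * Real.exp (-x) ≤ likelihood w.1 w.2 y) :
    ENNReal.ofReal (1 - (Real.exp (-((1 - α) * r)) / c + (n : ℝ) ^ 2 / (4 * s ^ 2))) ≤
      dataLaw X β {y | fracPosterior d α Z πβ y U ≤ ENNReal.ofReal (c * Real.exp x / m)} := by
  set G := {y | fracPosterior d α Z πβ y U ≤ ENNReal.ofReal (c * Real.exp x / m)} with hG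
  have h1 := dataLaw_numerator_le (prior d Z πβ) hα hc X β hr
  have h2 := dataLaw_totalScore_le X β hs
  have hcov : (Set.univ : Set (Network n)) ⊆ G ∪
      ({y | ENNReal.ofReal (likelihood X β y ^ α * c) ≤
        ∫⁻ w in U, ENNReal.ofReal (likelihood w.1 w.2 y ^ α) ∂(prior d Z πβ)} ∪
      {y | s ≤ |totalScore X β y|}) := fun y _ => by
    by_contra hy
    simp only [Set.mem_union, not_or, Set.mem_ofPred_eq, not_le] at hy
    obtain ⟨hyG, hy1, hy2⟩ := hy
    apply hyG
    have hf := likelihood_pos X β y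
    have hfα : 0 < likelihood X β y ^ α := Real.rpow_pos_of_pos hf _
    have h3 := denominator_ge (prior d Z πβ) hα0 hα.le hx hV (h y hy2.le)
    change fracPosterior d α Z πβ y U ≤ _
    rw [fracPosterior, Measure.smul_apply, withDensity_apply _ hU, smul_eq_mul]
    -- Outside both bad events the true likelihood to the power `α` cancels from the quotient.
    calc _ ≤ (ENNReal.ofReal (likelihood X β y ^ α * (Real.exp (-x) * m)))⁻¹ *
          ENNReal.ofReal (likelihood X β y ^ α * c) :=
          mul_le_mul' (ENNReal.inv_le_inv.2 h3) hy1.le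
      _ = ENNReal.ofReal (c * Real.exp x / m) := by
          rw [← ENNReal.ofReal_inv_of_pos (by positivity), ← ENNReal.ofReal_mul (by positivity),
            Real.exp_neg]
          congr 1
          field_simp
  have hsum : (1 : ENNReal) ≤ dataLaw X β G +
      ENNReal.ofReal (Real.exp (-((1 - α) * r)) / c + (n : ℝ) ^ 2 / (4 * s ^ 2)) := by
    calc (1 : ENNReal) = dataLaw X β Set.univ := measure_univ.symm
      _ ≤ _ := measure_mono hcov
      _ ≤ _ := (measure_union_le _ _).trans (add_le_add le_rfl (measure_union_le _ _))
      _ ≤ _ := by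
          rw [ENNReal.ofReal_add (by positivity) (by positivity)]
          gcongr
  rw [ENNReal.ofReal_sub _ (by positivity), ENNReal.ofReal_one]
  exact tsub_le_iff_right.2 hsum

/-! ### The complexity, the prior mass and the balance of exponents. -/

/-- `(1 + s_b + s_x) d log(np)`. -/
noncomputable def complexity (n p d sb sx : ℕ) : ℝ :=
  (1 + (sb : ℝ) + sx) * d * Real.log (n * p)

lemma rate_eq {M : ℝ} {n p d sb sx : ℕ} :
    rate M n p d sb sx = M * (√(complexity n p d sb sx) / n) := by
  rw [rate, complexity, Real.sqrt_div' _ (by positivity), Real.sqrt_sq (by positivity)]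

lemma sq_mul_rate_sq {M : ℝ} {n p d sb sx : ℕ} (hn : 1 ≤ n) (hS : 0 ≤ complexity n p d sb sx) :
    (n : ℝ) ^ 2 * rate M n p d sb sx ^ 2 = M ^ 2 * complexity n p d sb sx := by
  have : (0 : ℝ) < n := by exact_mod_cast hn
  rw [rate_eq, mul_pow, div_pow, Real.sq_sqrt hS]
  field_simp

lemma log_le_complexity {n p d sb sx : ℕ} (hn : 1 ≤ n) (hp : 1 ≤ p) (hd : 1 ≤ d) :
    Real.log n ≤ complexity n p d sb sx := by
  have hnR : (1 : ℝ) ≤ n := by exact_mod_cast hn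
  have hpR : (1 : ℝ) ≤ p := by exact_mod_cast hp
  have hdR : (1 : ℝ) ≤ d := by exact_mod_cast hd
  have h1 : Real.log n ≤ Real.log (n * p) := Real.log_le_log (by linarith) (by nlinarith)
  have h0 : 0 ≤ Real.log n := Real.log_nonneg hnR
  have h2 : (1 : ℝ) ≤ (1 + (sb : ℝ) + sx) * d := by
    have : (1 : ℝ) ≤ 1 + (sb : ℝ) + sx := by
      have : (0 : ℝ) ≤ (sb : ℝ) + sx := by positivity
      linarith
    nlinarith
  rw [complexity]
  nlinarith

lemma tendsto_complexity {p d sb sx : ℕ → ℕ} (hp : ∀ n, 1 ≤ p n) (hd : ∀ n, 1 ≤ d n) :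
    Tendsto (fun n => complexity n (p n) (d n) (sb n) (sx n)) atTop atTop := by
  refine tendsto_atTop_mono' atTop ?_ (Real.tendsto_log_atTop.comp tendsto_natCast_atTop_atTop)
  filter_upwards [eventually_ge_atTop 1] with n hn
  exact log_le_complexity hn (hp n) (hd n)

/-- Constant in the exponent of the lower bound for the prior mass. -/
noncomputable def massExponent (C₂ : ℝ) : ℝ := 2 * (6 * (⌈C₂⌉₊ + 9) + 20)

/-- For large `n` the constants are absorbed in `W`, so `B` and `X - ZB` have entries below a fixed
power of `W`. A power of `W` with exponent proportional to `(1 + s_b + s_x) d` is then exactly an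
exponential in the complexity. -/
lemma prior_ball_ge {n p d sb sx : ℕ} {C₁ C₂ C_B c_r c₅ b M : ℝ} {Z : Rows n p} {B : Rows p d}
    {X : Rows n d} {β : ℝ} {πβ : Measure ℝ} [IsProbabilityMeasure πβ] (hc_r : 0 ≤ c_r)
    (hZ : ∀ B : Rows p d, frobSq (fitted Z B) ≤ c_r * n * frobSq B)
    (hn : 2 ≤ n) (hp : 1 ≤ p) (hd : 1 ≤ d) (hdn : (d : ℝ) ≤ (n : ℝ) ^ 2)
    (hnC : C₁ ≤ n ∧ C_B ≤ n ∧ c_r ≤ n)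
    (hsb : rowSupport B ≤ sb) (hsx : rowSupport (X - fitted Z B) ≤ sx)
    (hB : ∀ j k, |B j k| ≤ C_B * (p : ℝ) ^ C₂) (hX : ∀ i k, |X i k| ≤ C₁)
    (hβ : ENNReal.ofReal (c₅ * Real.exp (-(M ^ 2 * complexity n p d sb sx))) ≤
      πβ {x | |x - β| ≤ b}) :
    ENNReal.ofReal (Real.exp (-((massExponent C₂ + M ^ 2) * complexity n p d sb sx)) * c₅) ≤
      prior d Z πβ ({x | ∀ i k, |x i k - X i k| ≤ (((n : ℝ) * p) ^ 5)⁻¹} ×ˢ {x | |x - β| ≤ b}) := by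
  obtain ⟨h1, h2, h3⟩ := hnC
  have hnR : (2 : ℝ) ≤ n := by exact_mod_cast hn
  have hpR : (1 : ℝ) ≤ p := by exact_mod_cast hp
  set W : ℝ := (n : ℝ) * p with hW
  have hnW : (n : ℝ) ≤ W := by nlinarith
  have hpW : (p : ℝ) ≤ W := by nlinarith
  have hW2 : 2 ≤ W := hnR.trans hnW
  have hW1 : 1 ≤ W := by linarith
  have hW0 : 0 < W := by linarith
  have hdW : (d : ℝ) ≤ W ^ 2 := hdn.trans (by gcongr)
  set k₀ := ⌈C₂⌉₊
  have hBk : ∀ j k, |B j k| ≤ W ^ (k₀ + 1) := fun j k => by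
    have h4 : (p : ℝ) ^ C₂ ≤ W ^ k₀ := by
      rw [← Real.rpow_natCast W]
      calc (p : ℝ) ^ C₂ ≤ (p : ℝ) ^ (k₀ : ℝ) := Real.rpow_le_rpow_of_exponent_le hpR (Nat.le_ceil _)
        _ ≤ W ^ (k₀ : ℝ) := Real.rpow_le_rpow (by positivity) hpW (by positivity)
    calc |B j k| ≤ C_B * (p : ℝ) ^ C₂ := hB j k
      _ ≤ W * (p : ℝ) ^ C₂ := by gcongr; linarith
      _ ≤ W * W ^ k₀ := by gcongr
      _ = _ := by ring
  have hlp := latentPrior_ball_ge (k₀ + 9) (by omega) hc_r hZ (by omega) hp hd rfl hW2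
    (h3.trans hnW) hdW hsb hsx
    (fun j k => (hBk j k).trans (pow_le_pow_right₀ hW1 (by omega)))
    (fun i k => by
      have h5 := abs_fitted_le hc_r hZ rfl (h3.trans hnW) hdW (by positivity) hBk i k
      calc _ ≤ |X i k| + |fitted Z B i k| := abs_sub _ _
        _ ≤ W ^ (k₀ + 3) + W ^ 2 * W ^ (k₀ + 1) := by
            gcongr
            exact (hX i k).trans ((h1.trans hnW).trans (le_self_pow₀ hW1 (by omega)))
        _ = 2 * W ^ (k₀ + 3) := by ring
        _ ≤ W * W ^ (k₀ + 3) := by gcongr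
        _ = W ^ (k₀ + 4) := by ring
        _ ≤ _ := pow_le_pow_right₀ hW1 (by omega))
  rw [prior, Measure.prod_prod]
  refine le_trans ?_ (mul_le_mul' hlp hβ)
  rw [← ENNReal.ofReal_mul (by positivity)]
  apply ENNReal.ofReal_le_ofReal
  have hexp : (W ^ ((6 * (k₀ + 9) + 20) * (2 * (1 + sb + sx) * d)))⁻¹ =
      Real.exp (-(massExponent C₂ * complexity n p d sb sx)) := by
    rw [Real.exp_neg]
    congr 1
    rw [massExponent, complexity, ← Real.exp_log (pow_pos hW0 _), Real.log_pow]
    push_cast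
    congr 1
    ring
  rw [hexp, mul_left_comm, ← Real.exp_add, mul_comm c₅]
  apply le_of_eq
  congr 2
  ring

/-- Since `D + 3η ≥ w + 1`, the main term supplies `-(w + 1)N`. The factor `w² N ≤ exp(2w + N)` uses
up `N` and at most `wN/4`, the score another `wN/4`, and all terms in `S` together at most `N/4 ≤
wN/4`. What remains is `-wN/4 ≤ -2S`. -/
lemma tail_exponent_le {N S D η w x A₁ A₂ c₅ : ℝ} (hS : 1 ≤ S) (hN : 8 * S ≤ N)
    (hA : (A₁ + A₂ + 1) * S ≤ N / 4) (hx : x ≤ w * N / 4 + A₂ * S) (hc₅ : 0 < c₅)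
    (hS5 : -Real.log c₅ ≤ S) (hη : 0 < η) (hD : 2 ≤ D) (hw : w = D - 1 + η) :
    Real.exp (-((D + 3 * η) * N)) * (w ^ 2 * N) * Real.exp x / (Real.exp (-(A₁ * S)) * c₅) ≤
      Real.exp (-S) := by
  have hw1 : 1 ≤ w := by linarith
  have hN0 : 0 < N := by linarith
  have hw2 : w ^ 2 ≤ Real.exp (2 * w) := by
    have h : w ≤ Real.exp w := by linarith [Real.add_one_le_exp w]
    calc w ^ 2 ≤ Real.exp w ^ 2 := by gcongr
      _ = _ := by rw [← Real.exp_nat_mul]; norm_num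
  have hNe : N ≤ Real.exp N := by linarith [Real.add_one_le_exp N]
  have hc : Real.exp (-S) ≤ c₅ := by
    rw [← Real.le_log_iff_exp_le hc₅]; linarith
  calc _ ≤ Real.exp (-((D + 3 * η) * N)) * (Real.exp (2 * w) * Real.exp N) * Real.exp x /
        (Real.exp (-(A₁ * S)) * Real.exp (-S)) := by gcongr
    _ = Real.exp (-((D + 3 * η) * N) + (2 * w + N) + x - (-(A₁ * S) + -S)) := by
        simp only [Real.exp_sub, Real.exp_add]
    _ ≤ _ := by
        apply Real.exp_le_exp.2
        have h1 : (w + 1) * N ≤ (D + 3 * η) * N := by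
          apply mul_le_mul_of_nonneg_right _ hN0.le; linarith
        have h2 : 8 * w ≤ w * N := by nlinarith
        have h3 : N ≤ w * N := by nlinarith
        nlinarith

/-- The radius `W⁻⁵` is dictated here: `n²` pairs, `d ≤ n²` coordinates and the constant `2C + 1`
cost at most `W² · W² · W`. -/
lemma sq_mul_logit_error_le {n d C W : ℝ} (hC : 0 < C) (hn : 1 ≤ n) (hnW : n ≤ W)
    (hCW : 2 * C + 1 ≤ W) (hd : 0 ≤ d) (hdn : d ≤ n ^ 2) :
    n ^ 2 * (d * (2 * C * (W ^ 5)⁻¹ + ((W ^ 5)⁻¹) ^ 2)) ≤ 1 := by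
  have hW0 : 0 < W := by linarith
  have h1 : ((W ^ 5)⁻¹) ≤ 1 := inv_le_one_of_one_le₀ (one_le_pow₀ (by linarith))
  have h0 : 0 < (W ^ 5)⁻¹ := by positivity
  calc _ ≤ W ^ 2 * (W ^ 2 * (2 * C * (W ^ 5)⁻¹ + 1 * (W ^ 5)⁻¹)) := by
        rw [sq (W ^ 5)⁻¹]
        gcongr
        exact hdn.trans (by gcongr)
    _ = W ^ 4 * (2 * C + 1) * (W ^ 5)⁻¹ := by ring
    _ ≤ W ^ 4 * W * (W ^ 5)⁻¹ := by gcongr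
    _ = 1 := by field_simp

/-- Bound for the loss in the log-likelihood over the prior ball. -/
lemma loss_le {n S M₀ M₁ c ε e w : ℝ} (hS0 : 0 ≤ S) (hS : 1 ≤ S) (hw : 0 ≤ w)
    (hM₀ : 0 ≤ M₀) (hM : 2 * (c * M₁) ≤ M₀) (hε : ε * n = M₁ * √S) (he0 : 0 ≤ e) (he : e ≤ 1 / 2)
    (hne : n ^ 2 * e ≤ 1) :
    c * ε * (w * n * √(M₀ ^ 2 * S) / 2) + n ^ 2 * e + n ^ 2 * (c * ε + e) ^ 2 ≤
      w * (M₀ ^ 2 * S) / 4 + (3 + 2 * (c * M₁) ^ 2) * S := by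
  have h3 : √S * √S = S := Real.mul_self_sqrt hS0
  have h1 : c * ε * (w * n * √(M₀ ^ 2 * S) / 2) ≤ w * (M₀ ^ 2 * S) / 4 := by
    rw [Real.sqrt_mul (sq_nonneg _), Real.sqrt_sq hM₀]
    have h2 : c * ε * (w * n * (M₀ * √S) / 2) = (w * M₀ * S) * (2 * (c * M₁)) / 4 := by
      linear_combination c * w * M₀ * √S / 2 * hε + c * w * M₀ * M₁ / 2 * h3
    have h4 : (w * M₀ * S) * (2 * (c * M₁)) ≤ (w * M₀ * S) * M₀ := by gcongr
    rw [h2]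
    linarith
  have h2 : n ^ 2 * (c * ε + e) ^ 2 ≤ 2 * (c * M₁) ^ 2 * S + 2 := by
    have h5 : (c * ε + e) ^ 2 ≤ 2 * (c * ε) ^ 2 + 2 * e ^ 2 := by
      linarith [sq_nonneg (c * ε - e)]
    have h4 : n ^ 2 * e ^ 2 ≤ 1 := by
      calc n ^ 2 * e ^ 2 = n ^ 2 * e * e := by ring
        _ ≤ 1 * 1 := by gcongr; linarith
        _ = 1 := one_mul 1
    calc _ ≤ n ^ 2 * (2 * (c * ε) ^ 2 + 2 * e ^ 2) := by gcongr
      _ = 2 * c ^ 2 * (ε * n) ^ 2 + 2 * (n ^ 2 * e ^ 2) := by ring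
      _ = 2 * (c * M₁) ^ 2 * (√S * √S) + 2 * (n ^ 2 * e ^ 2) := by rw [hε]; ring
      _ ≤ 2 * (c * M₁) ^ 2 * S + 2 * 1 := by rw [h3]; gcongr
      _ = _ := by ring
  linarith

/-- Concentration inequality for a fixed number of nodes. -/
lemma dataLaw_fracPosterior_renyi_ge {n p d sb sx : ℕ} {C₁ C₂ C_B c_r c₄ c₅ M₀ M₁ : ℝ}
    {Z : Rows n p} {B : Rows p d} {X : Rows n d} {β : ℝ} {πβ : Measure ℝ}
    [IsProbabilityMeasure πβ] (hC₁ : 0 < C₁) (hc_r : 0 ≤ c_r) (hc₅ : 0 < c₅) (hc₄ : 0 < c₄)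
    (hM₁ : 0 < M₁) (hM₀ : 3 ≤ M₀) (hM₀₁ : 2 * (c₄ * M₁) ≤ M₀)
    (hM₀₂ : 4 * (massExponent C₂ + M₁ ^ 2 + (3 + 2 * (c₄ * M₁) ^ 2) + 1) ≤ M₀)
    (hZ : ∀ B : Rows p d, frobSq (fitted Z B) ≤ c_r * n * frobSq B)
    (hn : 2 ≤ n) (hp : 1 ≤ p) (hd : 1 ≤ d) (hdn : (d : ℝ) ≤ (n : ℝ) ^ 2)
    (hnC : C₁ ≤ n ∧ C_B ≤ n ∧ c_r ≤ n) (hnC₁ : 2 * C₁ + 1 ≤ n)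
    (hS : 1 ≤ complexity n p d sb sx) (hS5 : -Real.log c₅ ≤ complexity n p d sb sx)
    (hrate : c₄ * rate M₁ n p d sb sx ≤ 1 / 2)
    (hsb : rowSupport B ≤ sb) (hsx : rowSupport (X - fitted Z B) ≤ sx)
    (hB : ∀ j k, |B j k| ≤ C_B * (p : ℝ) ^ C₂) (hX : ∀ i k, |X i k| ≤ C₁)
    (hβ : ENNReal.ofReal (c₅ * Real.exp (-((n : ℝ) ^ 2 * rate M₁ n p d sb sx ^ 2))) ≤
      πβ {x | |x - β| ≤ c₄ * rate M₁ n p d sb sx})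
    {α : ℝ} (hα0 : 0 < α) (hα1 : α < 1) {D η : ℝ} (hD : 2 ≤ D) (hη : 0 < η) :
    ENNReal.ofReal (1 - 2 / ((D - 1 + η) ^ 2 * (n : ℝ) ^ 2 * rate M₀ n p d sb sx ^ 2)) ≤
      dataLaw X β {y | fracPosterior d α Z πβ y
          {w | (D + 3 * η) / (1 - α) * rate M₀ n p d sb sx ^ 2 ≤
            1 / (n : ℝ) ^ 2 * renyi α (likelihood w.1 w.2) (likelihood X β)} ≤
        ENNReal.ofReal (Real.exp (-complexity n p d sb sx))} := by
  have hn1 : 1 ≤ n := by omega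
  have hnR : (2 : ℝ) ≤ n := by exact_mod_cast hn
  have hpR : (1 : ℝ) ≤ p := by exact_mod_cast hp
  set S := complexity n p d sb sx with hSdef
  have hS0 : 0 < S := by linarith
  have hr0 : (n : ℝ) ^ 2 * rate M₀ n p d sb sx ^ 2 = M₀ ^ 2 * S := sq_mul_rate_sq hn1 hS0.le
  have hr1 : (n : ℝ) ^ 2 * rate M₁ n p d sb sx ^ 2 = M₁ ^ 2 * S := sq_mul_rate_sq hn1 hS0.le
  have hrate₁ : rate M₁ n p d sb sx * n = M₁ * √S := by
    rw [rate_eq]; field_simp; rw [hSdef]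
  set ε₁ := rate M₁ n p d sb sx
  set N := M₀ ^ 2 * S with hN
  set w := D - 1 + η with hw
  have hw1 : 1 ≤ w := by linarith
  have hM₀2 : M₀ ≤ M₀ ^ 2 := le_self_pow₀ (by linarith) two_ne_zero
  have hM₀9 : 3 ^ 2 ≤ M₀ ^ 2 := by gcongr
  have hN8 : 8 * S ≤ N := by rw [hN]; apply mul_le_mul_of_nonneg_right _ hS0.le; linarith
  have hN0 : 0 < N := by linarith
  set W : ℝ := (n : ℝ) * p with hW
  have hnW : (n : ℝ) ≤ W := le_mul_of_one_le_right (by linarith) hpR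
  have hW0 : 0 < W := by linarith
  set e : ℝ := d * (2 * C₁ * (W ^ 5)⁻¹ + ((W ^ 5)⁻¹) ^ 2) with he
  have hε₁ : 0 ≤ ε₁ := by rw [← mul_nonneg_iff_of_pos_right (by linarith : (0 : ℝ) < n), hrate₁]; positivity
  have he0 : 0 ≤ e := by positivity
  have heW : (n : ℝ) ^ 2 * e ≤ 1 :=
    sq_mul_logit_error_le hC₁ (by linarith) hnW (hnC₁.trans hnW) (Nat.cast_nonneg d) hdn
  have he1 : e ≤ 1 / 2 := by
    have h1 : 2 * e ≤ (n : ℝ) ^ 2 * e :=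
      mul_le_mul_of_nonneg_right (hnR.trans (le_self_pow₀ (by linarith) two_ne_zero)) he0
    linarith
  -- Chosen so that Chebyshev's bound `n² / (4 s²)` equals `1 / (w² N)`.
  set s : ℝ := w * n * √N / 2 with hs
  have hs0 : 0 < s := by positivity
  set x : ℝ := c₄ * ε₁ * s + n ^ 2 * e + n ^ 2 * (c₄ * ε₁ + e) ^ 2 with hx
  have hprior := prior_ball_ge (b := c₄ * ε₁) (M := M₁) (c₅ := c₅) hc_r hZ hn hp hd hdn hnC hsb hsx
    hB hX (by rw [← hSdef, ← hr1]; exact hβ)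
  have hxle : x ≤ w * N / 4 + (3 + 2 * (c₄ * M₁) ^ 2) * S :=
    loss_le hS0.le hS (by linarith) (by linarith) hM₀₁ hrate₁ he0 he1 heW
  -- The threshold `c` is the mean bound `exp(-(D+3η)N)` inflated by `w² N`, so Markov's inequality
  -- also fails with probability at most `1 / (w² N)`.
  have hmain := dataLaw_fracPosterior_le_ge Z πβ (r := (D + 3 * η) / (1 - α) * N)
    (c := Real.exp (-((D + 3 * η) * N)) * (w ^ 2 * N)) (x := x) (s := s) hα0.le hα1
    (by positivity) (by positivity)
    (by positivity : 0 < Real.exp (-((massExponent C₂ + M₁ ^ 2) * S)) * c₅) hs0 X β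
    (U := {w | (D + 3 * η) / (1 - α) * rate M₀ n p d sb sx ^ 2 ≤
            1 / (n : ℝ) ^ 2 * renyi α (likelihood w.1 w.2) (likelihood X β)})
    (measurableSet_le measurable_const
      ((measurable_renyi_likelihood α (likelihood X β)).const_mul _))
    (fun v hv => by
      have hv' : (D + 3 * η) / (1 - α) * rate M₀ n p d sb sx ^ 2 ≤
        1 / (n : ℝ) ^ 2 * renyi α (likelihood v.1 v.2) (likelihood X β) := hv
      rw [one_div, ← div_eq_inv_mul, le_div_iff₀ (by positivity)] at hv'
      rw [← hr0]
      linarith)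
    hprior
    (fun y hy v hv => likelihood_ge hv.2 (abs_logit_sub_sub_le hX hv.1) he0
      (by linarith) hy)
  have h1α : 0 < 1 - α := by linarith
  have htail : Real.exp (-((1 - α) * ((D + 3 * η) / (1 - α) * N))) /
      (Real.exp (-((D + 3 * η) * N)) * (w ^ 2 * N)) + (n : ℝ) ^ 2 / (4 * s ^ 2) =
      2 / (w ^ 2 * (n : ℝ) ^ 2 * rate M₀ n p d sb sx ^ 2) := by
    have h2 : (1 - α) * ((D + 3 * η) / (1 - α) * N) = (D + 3 * η) * N := by field_simp
    have h3 : s ^ 2 = w ^ 2 * n ^ 2 * N / 4 := by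
      rw [hs, div_pow, mul_pow, mul_pow, Real.sq_sqrt hN0.le]; norm_num
    have h4 : w ^ 2 * (n : ℝ) ^ 2 * rate M₀ n p d sb sx ^ 2 = w ^ 2 * N := by
      rw [mul_assoc, hr0]
    rw [h2, h3, h4]
    field_simp
    norm_num
  rw [htail] at hmain
  refine hmain.trans (measure_mono fun y hy => le_trans hy (ENNReal.ofReal_le_ofReal ?_))
  refine tail_exponent_le hS hN8 ?_ hxle hc₅ hS5 hη hD hw
  have h5 : (massExponent C₂ + M₁ ^ 2 + (3 + 2 * (c₄ * M₁) ^ 2) + 1) * S ≤ M₀ ^ 2 / 4 * S :=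
    mul_le_mul_of_nonneg_right (by linarith) hS0.le
  rw [hN]
  linarith

end CALSM

/-! ### Choice of the constant and passage to large `n`. -/

open CALSM in
theorem theorem1
    -- the constants of the assumptions
    (C₁ C₂ C_B C_p C_r c_r M₁ c₄ c₅ : ℝ)
    (hC₁ : 0 < C₁) (hC₂ : 0 < C₂) (hC_B : 0 < C_B) (hC_p : 0 < C_p) (hC_r : 0 < C_r)
    (hc_r : 0 < c_r) (hM₁ : 0 < M₁) (hc₄ : 0 < c₄) (hc₅ : 0 < c₅) :
    ∃ Mbar : ℝ, 0 < Mbar ∧ ∀ M₀ : ℝ, Mbar ≤ M₀ →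
    ∀ (p d sb sx : ℕ → ℕ) (Z : ∀ n, Rows n (p n)) (B : ∀ n, Rows (p n) (d n))
      (X : ∀ n, Rows n (d n)) (β : ℕ → ℝ) (πβ : ℕ → Measure ℝ),
    (∀ n, 1 ≤ p n) → (∀ n, 1 ≤ d n) → (∀ n, IsProbabilityMeasure (πβ n)) →
    -- the sparse structure of the truth
    (∀ n, rowSupport (X n - fitted (Z n) (B n)) ≤ sx n) →
    (∀ n, rowSupport (B n) ≤ sb n) →
    -- magnitude of the true parameters
    (∀ n i k, |X n i k| ≤ C₁) →
    (∀ᶠ n in atTop, ∀ j k, |B n j k| ≤ C_B * (p n : ℝ) ^ C₂) →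
    -- restricted eigenvalues of the covariates
    (∀ᶠ n in atTop, RestrictedUpperEigenvalue (d n) (sb n) C_r c_r (Z n)) →
    -- the rate tends to zero, and `log p = O(log n)`
    Tendsto (fun n => rate M₁ n (p n) (d n) (sb n) (sx n)) atTop (𝓝 0) →
    (∀ᶠ n : ℕ in atTop, Real.log (p n) ≤ C_p * Real.log n) →
    -- sparsity level of the network
    Tendsto (fun n => rate M₁ n (p n) (d n) (sb n) (sx n) ^ 2 / Real.exp (β n)) atTop (𝓝 0) →
    -- prior of the sparsity parameter
    (∀ᶠ n : ℕ in atTop,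
      ENNReal.ofReal
          (c₅ * Real.exp (-((n : ℝ) ^ 2 * rate M₁ n (p n) (d n) (sb n) (sx n) ^ 2))) ≤
        πβ n {b | |b - β n| ≤ c₄ * rate M₁ n (p n) (d n) (sb n) (sx n)}) →
    ∀ α : ℝ, 0 < α → α < 1 →
    ∃ (n₀ : ℕ) (a : ℕ → ℝ), Tendsto a atTop (𝓝 0) ∧
      ∀ n, n₀ ≤ n → ∀ D η : ℝ, 2 ≤ D → 0 < η →
        ENNReal.ofReal (1 - 2 / ((D - 1 + η) ^ 2 * (n : ℝ) ^ 2 *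
            rate M₀ n (p n) (d n) (sb n) (sx n) ^ 2)) ≤
          dataLaw (X n) (β n) {y | fracPosterior (d n) α (Z n) (πβ n) y
              {w | (D + 3 * η) / (1 - α) * rate M₀ n (p n) (d n) (sb n) (sx n) ^ 2 ≤
                1 / (n : ℝ) ^ 2 *
                  renyi α (likelihood w.1 w.2) (likelihood (X n) (β n))} ≤
            ENNReal.ofReal (a n)} := by 
  -- The first summand gives `N ≥ 8S`, the second keeps the score term below `wN/4`, and the third
  -- makes the prior mass and deterministic losses at most `N/4`.
  refine ⟨3 + 2 * (c₄ * M₁) + 4 * (massExponent C₂ + M₁ ^ 2 + (3 + 2 * (c₄ * M₁) ^ 2) + 1),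
    by unfold massExponent; positivity, ?_⟩
  intro M₀ hM₀ p d sb sx Z B X β πβ hp hd hπβ hsx hsb hX hB hRE hrate _ _ hβ α hα0 hα1
  have hA : 0 < massExponent C₂ + M₁ ^ 2 + (3 + 2 * (c₄ * M₁) ^ 2) + 1 := by
    unfold massExponent; positivity
  have hc₄M₁ : 0 < c₄ * M₁ := by positivity
  have hS := tendsto_complexity (sb := sb) (sx := sx) hp hd
  have hnat := tendsto_natCast_atTop_atTop (R := ℝ)
  have hr : ∀ᶠ n in atTop, rate M₁ n (p n) (d n) (sb n) (sx n) ≤ min M₁ (1 / (2 * c₄)) :=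
    hrate.eventually_le_const (by positivity)
  obtain ⟨n₀, hn₀⟩ := eventually_atTop.1 (hB.and (hRE.and (hr.and (hβ.and
    ((hS.eventually_ge_atTop 1).and ((hS.eventually_ge_atTop (-Real.log c₅)).and
    ((hnat.eventually_ge_atTop (2 * C₁ + 1)).and ((hnat.eventually_ge_atTop C_B).and
    ((hnat.eventually_ge_atTop c_r).and (eventually_ge_atTop 3))))))))))
  -- Neither `n₀` nor this sequence depends on `D` or `η`.
  refine ⟨n₀, fun n => Real.exp (-complexity n (p n) (d n) (sb n) (sx n)),
    Real.tendsto_exp_neg_atTop_nhds_zero.comp hS, fun n hn D η hD hη => ?_⟩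
  obtain ⟨hBn, hREn, hrn, hβn, hS1, hS5, hn1, hn2, hn3, hn4⟩ := hn₀ n hn
  have hnR : (3 : ℝ) ≤ n := by exact_mod_cast hn4
  have hpR : (1 : ℝ) ≤ p n := by exact_mod_cast hp n
  have hdR : (1 : ℝ) ≤ d n := by exact_mod_cast hd n
  -- Here `n ≥ 3 > e`. Together with `S ≤ n²`, which is `ε_n(M₁) ≤ M₁` rewritten, this yields `d ≤ S
  -- ≤ n²`.
  have hlog : 1 ≤ Real.log (n * p n) := by
    rw [Real.le_log_iff_exp_le (by positivity)]
    nlinarith [Real.exp_one_lt_d9]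
  have hpos : 0 < C_r * (max (sb n) 1 : ℕ) * d n * Real.log (n * p n) := by
    have : (0 : ℝ) < (max (sb n) 1 : ℕ) := by exact_mod_cast (by omega)
    positivity
  have hSn : complexity n (p n) (d n) (sb n) (sx n) ≤ (n : ℝ) ^ 2 := by
    have h1 := sq_mul_rate_sq (M := M₁) (by omega : 1 ≤ n) (zero_le_one.trans hS1)
    have h2 : rate M₁ n (p n) (d n) (sb n) (sx n) ^ 2 ≤ M₁ ^ 2 := by
      apply pow_le_pow_left₀ _ (hrn.trans (min_le_left _ _))
      rw [rate_eq]; positivity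
    have h3 : (n : ℝ) ^ 2 * rate M₁ n (p n) (d n) (sb n) (sx n) ^ 2 ≤ (n : ℝ) ^ 2 * M₁ ^ 2 := by
      gcongr
    rw [h1, mul_comm] at h3
    exact le_of_mul_le_mul_right h3 (by positivity)
  have hdn : (d n : ℝ) ≤ (n : ℝ) ^ 2 := by
    refine le_trans ?_ hSn
    rw [complexity]
    have : (1 : ℝ) ≤ 1 + (sb n : ℝ) + sx n := by
      have : (0 : ℝ) ≤ (sb n : ℝ) + sx n := by positivity
      linarith
    calc (d n : ℝ) = 1 * d n * 1 := by ring
      _ ≤ _ := by gcongr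
  have hr4 : c₄ * rate M₁ n (p n) (d n) (sb n) (sx n) ≤ 1 / 2 := by
    calc _ ≤ c₄ * (1 / (2 * c₄)) := by gcongr; exact hrn.trans (min_le_right _ _)
      _ = _ := by field_simp
  have := hπβ n
  exact dataLaw_fracPosterior_renyi_ge hC₁ hc_r.le hc₅ hc₄ hM₁ (by linarith) (by linarith)
    (by linarith) (hREn.frobSq_fitted_le hpos) (by omega) (hp n) (hd n) hdn
    ⟨by linarith, hn2, hn3⟩ hn1 hS1 hS5 hr4 (hsb n) (hsx n) hBn (hX n) hβn hα0 hα1 hD hη
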